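/- Let $\omega=\sum_{i=1}^n\omega_i\delta_{x_i}$ and $v=\sum_{i=1}^n v_i\delta_{x_i}$ be finitely supported measures on $\mathbb R$ with $\omega_i\in\mathbb R$, $v_i\ge 0$, $|\omega_i|+v_i>0$ ($n$, the $x_i$ and the weights are arbitrary). Consider $$-f''+\tfrac14 f=z\,\omega f+z^2 v f\quad\text{on }\mathbb R$$ in the sense of distributions: $f$ is continuous, $-f''+\frac14f=0$ off $\{x_1,\dots,x_n\}$, and $f'(x_i-)=f'(x_i+)+(z\omega_i+z^2v_i)f(x_i)$. Put $f'(x_i):=f'(x_i-)$. The eigenvalues are the $z\in\mathbb C$ that admit a nontrivial bounded solution; they are real, nonzero and finite in number, $\lambda_1<\dots<\lambda_N$. Let $\phi_\pm(z,\cdot)$ be the solution equal to $e^{\mp x/2}$ near $\pm\infty$, let $\gamma_{\lambda}^2=\int|\phi_+(\lambda,x)|^2d\omega(x)+2\lambda\int|\phi_+(\lambda,x)|^2dv(x)$, and let $\varphi_i(x)=\phi_+(\lambda_i,x)/\sqrt{\lambda_i\gamma_{\lambda_i}^2}$. For $a\in\mathbb R$, $\{\lambda_i,\varphi_i(a)\}_{i=1}^N$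 is called the interior spectral data of $(\omega,v)$ at $a$. The Weyl–Titchmarsh functions are $M_\pm(z,a)=\pm\phi_\pm'(z,a)/(z\phi_\pm(z,a))$. **Theorem.** Let $a\in\mathbb R$ and let $\{\lambda_i,\varphi_i(a)\}_{i=1}^N$ be the interior spectral data at $a$ of some pair $(\omega,v)$. Suppose that $$\alpha:=1-\sum_{i=1}^N|\varphi_i(a)|^2=0,\qquad \beta:=-\sum_{i=1}^N\lambda_i|\varphi_i(a)|^2=0,\qquad \varphi_i(a)\ne0\quad(i=1,\dots,N).$$ Then exactly one pair $(\omega,v)$ has the interior spectral data $\{\lambda_i,\varphi_i(a)\}_{i=1}^N$ at $a$. Moreover, the pair can be reconstructed from the data as follows. Let $G(z)=\sum_{i=1}^N\frac{\lambda_i^2|\varphi_i(a)|^2}{\lambda_i-z}$, and let $Z$ be the set of zeros $\mu\ne0$ of $G$ that lie in an interval $(\lambda_j,\lambda_{j+1})$, $1\le j<N$, with $\varphi_j(a)\varphi_{j+1}(a)>0$. Put $$M_-(z)=-\frac1{2z}+\sum_{\mu\in Z}\frac{1}{G'(\mu)(\mu-z)},\qquad M_+(z)=-\frac1{G(z)}-M_-(z).$$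 There is exactly one pair $(\omega,v)$ with $M_\pm(z,a)=M_\pm(z)$ for all $z\in\mathbb C\setminus\mathbb R$, and this pair has the interior spectral data $\{\lambda_i,\varphi_i(a)\}_{i=1}^N$ at $a$. -/

import Mathlib

open Filter Topology

noncomputable section

namespace Peakon

/-- A pair of finitely supported measures `ω = ∑ ω(x) δ_x` and `v = ∑ v(x) δ_x` on the real line,
with real weights `ω(x)` and nonnegative weights `v(x)`.  The number of point masses is arbitrary.
A discrete measure is stored as the function giving its mass at every point, so that two pairs are
equal if and only if their measures are. -/
@[ext]
structure DiscretePair where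
  omega : ℝ →₀ ℝ
  v : ℝ →₀ ℝ
  v_nonneg : ∀ x, 0 ≤ v x

/-- The points `x_1, …, x_n` with `|ω(x_i)| + v(x_i) > 0`. -/
def DiscretePair.points (P : DiscretePair) : Finset ℝ := P.omega.support ∪ P.v.support

/-- `f` solves `-f'' + f / 4 = (∑_{s ∈ S} k(s) δ_s) f` in the sense of distributions:
`f` is continuous, satisfies `-f'' + f / 4 = 0` off `S`, and
`f'(s-) = f'(s+) + k(s) f(s)` for all `s ∈ S`. -/
structure IsJumpSolution (S : Finset ℝ) (k : ℝ → ℂ) (f : ℝ → ℂ) : Prop where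
  continuous : Continuous f
  differentiableAt : ∀ x ∉ S, DifferentiableAt ℝ f x
  ode : ∀ x ∉ S, HasDerivAt (deriv f) (f x / 4) x
  jump : ∀ s ∈ S, ∃ l r : ℂ, Tendsto (deriv f) (𝓝[<] s) (𝓝 l) ∧
    Tendsto (deriv f) (𝓝[>] s) (𝓝 r) ∧ l = r + k s * f s

/-- `f` solves `-f'' + f / 4 = z ω f + z² v f` in the sense of distributions. -/
def IsSolution (P : DiscretePair) (z : ℂ) (f : ℝ → ℂ) : Prop :=
  IsJumpSolution P.points (fun x => z * P.omega x + z ^ 2 * P.v x) f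

/-- The spectrum: the `z` for which there is a nontrivial bounded solution. -/
def spec (P : DiscretePair) : Set ℂ :=
  {z | ∃ f : ℝ → ℂ, IsSolution P z f ∧ f ≠ 0 ∧ ∃ C : ℝ, ∀ x, ‖f x‖ ≤ C}

namespace IsJumpSolution

variable {S : Finset ℝ} {k : ℝ → ℂ} {f g : ℝ → ℂ}

theorem eventually_not_mem_right (S : Finset ℝ) (s : ℝ) : ∀ᶠ x in 𝓝[>] s, x ∉ S := by
  have h : ∀ᶠ x in 𝓝[≠] s, x ∉ (S : Set ℝ) := by
    have := (S.finite_toSet.subset (t := (S : Set ℝ) \ {s}) Set.sdiff_subset).isClosed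
    have h2 : ((S : Set ℝ) \ {s})ᶜ ∈ 𝓝 s := this.isOpen_compl.mem_nhds (by simp)
    filter_upwards [mem_nhdsWithin_of_mem_nhds h2, self_mem_nhdsWithin] with x hx hx' hS
    exact hx ⟨hS, hx'⟩
  exact h.filter_mono (nhdsWithin_mono s (fun x (hx : s < x) => ne_of_gt hx))

theorem eventually_not_mem_left (S : Finset ℝ) (s : ℝ) : ∀ᶠ x in 𝓝[<] s, x ∉ S := by
  have h : ∀ᶠ x in 𝓝[≠] s, x ∉ (S : Set ℝ) := by
    have := (S.finite_toSet.subset (t := (S : Set ℝ) \ {s}) Set.sdiff_subset).isClosed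
    have h2 : ((S : Set ℝ) \ {s})ᶜ ∈ 𝓝 s := this.isOpen_compl.mem_nhds (by simp)
    filter_upwards [mem_nhdsWithin_of_mem_nhds h2, self_mem_nhdsWithin] with x hx hx' hS
    exact hx ⟨hS, hx'⟩
  exact h.filter_mono (nhdsWithin_mono s (fun x (hx : x < s) => ne_of_lt hx))

theorem neg_comp (h : IsJumpSolution S k f) :
    IsJumpSolution (S.image (fun x => -x)) (fun x => k (-x)) (fun x => f (-x)) := by
  have hd : deriv (fun x => f (-x)) = fun x => -deriv f (-x) := by
    funext x; exact deriv_comp_neg f x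
  have hmem : ∀ x, x ∉ S.image (fun x => -x) → -x ∉ S := by
    intro x hx hS
    exact hx (Finset.mem_image.2 ⟨-x, hS, by simp⟩)
  refine ⟨h.continuous.comp continuous_neg, ?_, ?_, ?_⟩
  · intro x hx
    have := h.differentiableAt (-x) (hmem x hx)
    exact this.comp x (differentiable_neg x)
  · intro x hx
    rw [hd]
    have h1 := h.ode (-x) (hmem x hx)
    have h2 := (h1.scomp x (hasDerivAt_neg x)).neg
    refine h2.congr_deriv ?_
    simp
  · intro s hs
    obtain ⟨t, ht, rfl⟩ := Finset.mem_image.1 hs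
    obtain ⟨l, r, hl, hr, hlr⟩ := h.jump t ht
    refine ⟨-r, -l, ?_, ?_, ?_⟩
    · rw [hd]
      have : Tendsto (fun x : ℝ => -x) (𝓝[<] (-t)) (𝓝[>] t) := by
        simpa using tendsto_neg_nhdsLT (a := -t)
      exact (hr.comp this).neg
    · rw [hd]
      have : Tendsto (fun x : ℝ => -x) (𝓝[>] (-t)) (𝓝[<] t) := by
        simpa using tendsto_neg_nhdsGT (a := -t)
      exact (hl.comp this).neg
    · simp [hlr]

theorem deriv_tendsto_of_not_mem (h : IsJumpSolution S k f) {x : ℝ} (hx : x ∉ S) :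
    Tendsto (deriv f) (𝓝 x) (𝓝 (deriv f x)) :=
  (h.ode x hx).continuousAt

theorem sub (hf : IsJumpSolution S k f) (hg : IsJumpSolution S k g) :
    IsJumpSolution S k (fun x => f x - g x) := by
  have hd : ∀ x ∉ S, deriv (fun x => f x - g x) x = deriv f x - deriv g x := fun x hx =>
    deriv_fun_sub (hf.differentiableAt x hx) (hg.differentiableAt x hx)
  refine ⟨hf.continuous.sub hg.continuous,
    fun x hx => (hf.differentiableAt x hx).sub (hg.differentiableAt x hx), ?_, ?_⟩
  · intro x hx
    have h1 := (hf.ode x hx).sub (hg.ode x hx)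
    have h2 : deriv (fun x => f x - g x) =ᶠ[𝓝 x] (deriv f - deriv g) := by
      have : ((S : Set ℝ))ᶜ ∈ 𝓝 x := S.finite_toSet.isClosed.isOpen_compl.mem_nhds (by simpa using hx)
      filter_upwards [this] with y hy
      exact hd y (by simpa using hy)
    refine (h1.congr_of_eventuallyEq h2).congr_deriv ?_
    ring
  · intro s hs
    obtain ⟨l, r, hl, hr, hlr⟩ := hf.jump s hs
    obtain ⟨l', r', hl', hr', hlr'⟩ := hg.jump s hs
    refine ⟨l - l', r - r', (hl.sub hl').congr' ?_, (hr.sub hr').congr' ?_, ?_⟩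
    · filter_upwards [eventually_not_mem_left S s] with y hy using (hd y hy).symm
    · filter_upwards [eventually_not_mem_right S s] with y hy using (hd y hy).symm
    · rw [hlr, hlr']; ring

theorem eq_zero_of_eventually (h : IsJumpSolution S k f) (h0 : ∀ᶠ x in atTop, f x = 0) :
    f = 0 := by
  by_contra hne
  obtain ⟨y0, hy0⟩ : ∃ y, f y ≠ 0 := by
    by_contra hh; push Not at hh; exact hne (funext hh)
  obtain ⟨b, hb⟩ := eventually_atTop.1 h0
  set A : Set ℝ := {y | f y ≠ 0} with hA
  have hbd : BddAbove A := ⟨b, fun y hy => by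
    by_contra hlt; exact hy (hb y (le_of_lt (not_le.1 hlt)))⟩
  have hne' : A.Nonempty := ⟨y0, hy0⟩
  set c := sSup A with hc
  have hzero : ∀ x, c < x → f x = 0 := by
    intro x hx
    by_contra hfx
    exact absurd (le_csSup hbd hfx) (not_le.2 hx)
  have hfc : f c = 0 := by
    have h1 : Tendsto f (𝓝[>] c) (𝓝 (f c)) := h.continuous.continuousAt.mono_left nhdsWithin_le_nhds
    have h2 : Tendsto f (𝓝[>] c) (𝓝 0) := by
      refine tendsto_const_nhds.congr' ?_
      filter_upwards [self_mem_nhdsWithin] with x hx using (hzero x hx).symm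
    exact tendsto_nhds_unique h1 h2
  have hdr : Tendsto (deriv f) (𝓝[>] c) (𝓝 0) := by
    refine tendsto_const_nhds.congr' ?_
    filter_upwards [self_mem_nhdsWithin] with x hx
    have : f =ᶠ[𝓝 x] fun _ => (0 : ℂ) := by
      filter_upwards [Ioi_mem_nhds hx] with y hy using hzero y hy
    rw [this.deriv_eq]; simp
  have hdl : Tendsto (deriv f) (𝓝[<] c) (𝓝 0) := by
    by_cases hcS : c ∈ S
    · obtain ⟨l, r, hl, hr, hlr⟩ := h.jump c hcS
      have : r = 0 := tendsto_nhds_unique hr hdr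
      rw [this, hfc] at hlr
      simpa [hlr] using hl
    · have h1 := h.deriv_tendsto_of_not_mem hcS
      have h2 : deriv f c = 0 := tendsto_nhds_unique (h1.mono_left nhdsWithin_le_nhds) hdr
      rw [h2] at h1
      exact h1.mono_left nhdsWithin_le_nhds
  have hfl : Tendsto f (𝓝[<] c) (𝓝 0) := by
    rw [← hfc]; exact h.continuous.continuousAt.mono_left nhdsWithin_le_nhds
  obtain ⟨d, hd, hdS⟩ : ∃ d < c, ∀ x ∈ Set.Ioo d c, x ∉ S := by
    have := eventually_not_mem_left S c
    rw [Filter.Eventually, mem_nhdsLT_iff_exists_Ioo_subset] at this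
    obtain ⟨d, hd, hsub⟩ := this
    exact ⟨d, hd, fun x hx => hsub hx⟩
  have key : ∀ e : ℂ, e ^ 2 = 1 / 4 → ∀ x ∈ Set.Ioo d c, deriv f x + e * f x = 0 := by
    intro e he x hx
    set u : ℝ → ℂ := fun y => (deriv f y + e * f y) * Complex.exp (-(e * y)) with hu
    have hder : ∀ y ∈ Set.Ioo d c, HasDerivAt u 0 y := by
      intro y hy
      have h1 := h.ode y (hdS y hy)
      have h2 := (h.differentiableAt y (hdS y hy)).hasDerivAt
      have h3 : HasDerivAt (fun y : ℝ => Complex.exp (-(e * y)))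
          (Complex.exp (-(e * y)) * (-(e * 1))) y :=
        (((hasDerivAt_id y).ofReal_comp).const_mul e).neg.cexp
      have h4 := (h1.add (h2.const_mul e)).mul h3
      refine (h4.congr_deriv ?_)
      change _ + (deriv f y + e * f y) * _ = 0
      linear_combination -(Complex.exp (-(e * y)) * f y) * he
    have hconst : ∀ y ∈ Set.Ioo d c, u y = u x := by
      intro y hy
      exact (convex_Ioo d c).is_const_of_fderivWithin_eq_zero (𝕜 := ℝ) (f := u)
        (fun w hw => (hder w hw).differentiableAt.differentiableWithinAt)
        (fun w hw => by
          rw [fderivWithin_of_isOpen isOpen_Ioo hw]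
          ext
          simp [(hder w hw).deriv])
        hy hx
    have hlim : Tendsto u (𝓝[<] c) (𝓝 0) := by
      have h1 : Tendsto (fun y : ℝ => Complex.exp (-(e * y))) (𝓝[<] c)
          (𝓝 (Complex.exp (-(e * c)))) := by
        have : Continuous (fun y : ℝ => Complex.exp (-(e * y))) := by fun_prop
        exact this.continuousAt.mono_left nhdsWithin_le_nhds
      simpa using (hdl.add (hfl.const_mul e)).mul h1
    have hlim2 : Tendsto u (𝓝[<] c) (𝓝 (u x)) := by
      refine tendsto_const_nhds.congr' ?_
      filter_upwards [Ioo_mem_nhdsLT hd] with y hy using (hconst y hy).symm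
    have hux : u x = 0 := tendsto_nhds_unique hlim2 hlim
    simpa [hu, Complex.exp_ne_zero] using hux
  have hz : ∀ x ∈ Set.Ioo d c, f x = 0 := by
    intro x hx
    have h1 := key (1 / 2) (by norm_num) x hx
    have h2 := key (-(1 / 2)) (by norm_num) x hx
    linear_combination h1 - h2
  have : c ≤ d := by
    refine csSup_le hne' (fun y hy => ?_)
    by_contra hlt
    rw [not_le] at hlt
    rcases lt_trichotomy y c with h1 | h1 | h1
    · exact hy (hz y ⟨hlt, h1⟩)
    · exact hy (h1 ▸ hfc)
    · exact hy (hzero y h1)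
  exact absurd hd (not_lt.2 this)

theorem exists_plus (S : Finset ℝ) (k : ℝ → ℂ) :
    ∃ f, IsJumpSolution S k f ∧ ∀ᶠ x in atTop, f x = Complex.exp (-(x : ℂ) / 2) := by
  induction S using Finset.induction_on_min with
  | empty =>
    have h1 : ∀ x : ℝ, HasDerivAt (fun x : ℝ => Complex.exp (-(x : ℂ) / 2))
        (Complex.exp (-(x : ℂ) / 2) * (-1 / 2)) x := fun x =>
      ((((hasDerivAt_id x).ofReal_comp).neg).div_const 2).cexp
    refine ⟨fun x => Complex.exp (-(x : ℂ) / 2), ⟨by fun_prop, ?_, ?_, by simp⟩, by simp⟩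
    · intro x _; exact (h1 x).differentiableAt
    · intro x _
      have h2 : deriv (fun x : ℝ => Complex.exp (-(x : ℂ) / 2)) =
          fun x : ℝ => Complex.exp (-(x : ℂ) / 2) * (-1 / 2) := funext fun x => (h1 x).deriv
      rw [h2]
      refine ((h1 x).mul_const (-1 / 2 : ℂ)).congr_deriv ?_
      ring
  | insert p S hp ih =>
    obtain ⟨f, hf, hfe⟩ := ih
    have hpS : p ∉ S := fun h => lt_irrefl _ (hp p h)
    set C : ℂ := 2 * k p * f p with hC
    set s : ℝ → ℂ := fun x => C * Complex.sinh (((p : ℂ) - x) / 2) with hs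
    have hs1 : ∀ x : ℝ, HasDerivAt s (C * (Complex.cosh (((p : ℂ) - x) / 2) * (-1 / 2))) x := by
      intro x
      exact (((((hasDerivAt_id (x : ℂ)).const_sub (p : ℂ)).div_const 2).csinh).const_mul
        C).comp_ofReal
    have hs2 : ∀ x : ℝ, HasDerivAt (fun x : ℝ => C * (Complex.cosh (((p : ℂ) - x) / 2) * (-1 / 2)))
        (s x / 4) x := by
      intro x
      have := ((((((hasDerivAt_id (x : ℂ)).const_sub (p : ℂ)).div_const 2).ccosh).mul_const
        (-1 / 2 : ℂ)).const_mul C).comp_ofReal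
      refine this.congr_deriv ?_
      simp only [hs, id]; ring
    have hsc : Continuous s := by fun_prop
    set g : ℝ → ℂ := fun x => if x ≤ p then f x - s x else f x with hg
    have hlt : ∀ x, x < p → g =ᶠ[𝓝 x] fun y => f y - s y := by
      intro x hx
      filter_upwards [Iio_mem_nhds hx] with y hy
      simp [hg, le_of_lt (Set.mem_Iio.1 hy)]
    have hgt : ∀ x, p < x → g =ᶠ[𝓝 x] f := by
      intro x hx
      filter_upwards [Ioi_mem_nhds hx] with y hy
      simp [hg, not_le.2 (Set.mem_Ioi.1 hy)]
    have hSlt : ∀ x, x ≤ p → x ∉ S := fun x hx h => absurd (hp x h) (not_lt.2 hx)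
    have hdlt : ∀ x, x < p → deriv g x = deriv f x -
        C * (Complex.cosh (((p : ℂ) - x) / 2) * (-1 / 2)) := by
      intro x hx
      rw [(hlt x hx).deriv_eq]
      exact ((hf.differentiableAt x (hSlt x hx.le)).hasDerivAt.sub (hs1 x)).deriv
    have hdgt : ∀ x, p < x → deriv g x = deriv f x := fun x hx => (hgt x hx).deriv_eq
    refine ⟨g, ⟨?_, ?_, ?_, ?_⟩, ?_⟩
    · refine Continuous.if_le (hf.continuous.sub hsc) hf.continuous continuous_id
        continuous_const ?_
      intro x hx
      have : x = p := hx
      simp [hs, this]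
    · intro x hx
      simp only [Finset.mem_insert, not_or] at hx
      rcases lt_or_gt_of_ne hx.1 with h | h
      · exact ((hf.differentiableAt x hx.2).sub (hs1 x).differentiableAt).congr_of_eventuallyEq
          (hlt x h)
      · exact (hf.differentiableAt x hx.2).congr_of_eventuallyEq (hgt x h)
    · intro x hx
      simp only [Finset.mem_insert, not_or] at hx
      rcases lt_or_gt_of_ne hx.1 with h | h
      · have h1 := (hf.ode x hx.2).sub (hs2 x)
        have h2 : g x = f x - s x := by simp [hg, h.le]
        have h3 : deriv g =ᶠ[𝓝 x] (deriv f - fun x : ℝ =>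
            C * (Complex.cosh (((p : ℂ) - x) / 2) * (-1 / 2))) := by
          filter_upwards [Iio_mem_nhds h] with y hy using hdlt y hy
        refine (h1.congr_of_eventuallyEq h3).congr_deriv ?_
        rw [h2]; ring
      · have h2 : g x = f x := by simp [hg, not_le.2 h]
        rw [h2]
        refine (hf.ode x hx.2).congr_of_eventuallyEq ?_
        filter_upwards [Ioi_mem_nhds h] with y hy using hdgt y hy
    · intro t ht
      rcases Finset.mem_insert.1 ht with rfl | htS
      · have h0 := hf.deriv_tendsto_of_not_mem hpS
        refine ⟨deriv f t + C / 2, deriv f t, ?_, ?_, ?_⟩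
        · have h1 : Tendsto (fun x : ℝ => deriv f x -
              C * (Complex.cosh (((t : ℂ) - x) / 2) * (-1 / 2))) (𝓝[<] t)
              (𝓝 (deriv f t - C * (Complex.cosh (((t : ℂ) - t) / 2) * (-1 / 2)))) := by
            have hcont : Continuous (fun x : ℝ =>
              C * (Complex.cosh (((t : ℂ) - x) / 2) * (-1 / 2))) := by fun_prop
            exact (h0.sub hcont.continuousAt).mono_left nhdsWithin_le_nhds
          have h2 : deriv f t - C * (Complex.cosh (((t : ℂ) - t) / 2) * (-1 / 2)) =
              deriv f t + C / 2 := by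
            simp; ring
          rw [h2] at h1
          refine h1.congr' ?_
          filter_upwards [self_mem_nhdsWithin] with y hy using (hdlt y hy).symm
        · refine (h0.mono_left nhdsWithin_le_nhds).congr' ?_
          filter_upwards [self_mem_nhdsWithin] with y hy using (hdgt y hy).symm
        · have : g t = f t := by simp [hg, hs]
          rw [this, hC]; ring
      · have hpt := hp t htS
        obtain ⟨l, r, hl, hr, hlr⟩ := hf.jump t htS
        have hev : deriv f =ᶠ[𝓝 t] deriv g := by
          filter_upwards [Ioi_mem_nhds hpt] with y hy using (hdgt y hy).symm
        refine ⟨l, r, hl.congr' (hev.filter_mono nhdsWithin_le_nhds),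
          hr.congr' (hev.filter_mono nhdsWithin_le_nhds), ?_⟩
        have : g t = f t := by simp [hg, not_le.2 hpt]
        rw [this]; exact hlr
    · filter_upwards [hfe, eventually_gt_atTop p] with x hx hxp
      simp [hg, not_le.2 hxp, hx]

theorem existsUnique_plus (S : Finset ℝ) (k : ℝ → ℂ) :
    ∃! f, IsJumpSolution S k f ∧ ∀ᶠ x in atTop, f x = Complex.exp (-(x : ℂ) / 2) := by
  obtain ⟨f, hf, hfe⟩ := exists_plus S k
  refine ⟨f, ⟨hf, hfe⟩, ?_⟩
  rintro g ⟨hg, hge⟩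
  have := (hg.sub hf).eq_zero_of_eventually (by
    filter_upwards [hfe, hge] with x h1 h2
    rw [h1, h2, sub_self])
  funext x
  exact sub_eq_zero.1 (congrFun this x)

theorem existsUnique_minus (S : Finset ℝ) (k : ℝ → ℂ) :
    ∃! f, IsJumpSolution S k f ∧ ∀ᶠ x in atBot, f x = Complex.exp ((x : ℂ) / 2) := by
  obtain ⟨f, ⟨hf, hfe⟩, hu⟩ := existsUnique_plus (S.image (fun x => -x)) (fun x => k (-x))
  have hS : (S.image (fun x => -x)).image (fun x => -x) = S := by
    rw [Finset.image_image]; simp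
  refine ⟨fun x => f (-x), ⟨?_, ?_⟩, ?_⟩
  · have := hf.neg_comp
    simpa only [hS, neg_neg] using this
  · filter_upwards [tendsto_neg_atBot_atTop.eventually hfe] with x hx
    rw [hx]; simp
  · rintro g ⟨hg, hge⟩
    have := hu (fun x => g (-x)) ⟨hg.neg_comp, by
      filter_upwards [tendsto_neg_atTop_atBot.eventually hge] with x hx
      rw [hx]; simp⟩
    funext x
    have h := congrFun this (-x)
    simpa using h

end IsJumpSolution

/-- The unique solution `φ₊(z, ·)` that equals `e^{-x/2}` for all `x` near `+∞`. -/
def phiPlus (P : DiscretePair) (z : ℂ) : ℝ → ℂ :=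
  (IsJumpSolution.existsUnique_plus P.points
    (fun x => z * P.omega x + z ^ 2 * P.v x)).choose

/-- The unique solution `φ₋(z, ·)` that equals `e^{x/2}` for all `x` near `-∞`. -/
def phiMinus (P : DiscretePair) (z : ℂ) : ℝ → ℂ :=
  (IsJumpSolution.existsUnique_minus P.points
    (fun x => z * P.omega x + z ^ 2 * P.v x)).choose

theorem phiPlus_spec (P : DiscretePair) (z : ℂ) :
    IsSolution P z (phiPlus P z) ∧ ∀ᶠ x in atTop, phiPlus P z x = Complex.exp (-(x : ℂ) / 2) :=
  (IsJumpSolution.existsUnique_plus P.points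
    (fun x => z * P.omega x + z ^ 2 * P.v x)).choose_spec.1

theorem phiMinus_spec (P : DiscretePair) (z : ℂ) :
    IsSolution P z (phiMinus P z) ∧ ∀ᶠ x in atBot, phiMinus P z x = Complex.exp ((x : ℂ) / 2) :=
  (IsJumpSolution.existsUnique_minus P.points
    (fun x => z * P.omega x + z ^ 2 * P.v x)).choose_spec.1

/-- `γ_λ² = ∫ |φ₊(λ, x)|² dω(x) + 2 λ ∫ |φ₊(λ, x)|² dv(x)`. -/
def gammaSq (P : DiscretePair) (lam : ℝ) : ℝ :=
  ∑ x ∈ P.points, ‖phiPlus P lam x‖ ^ 2 * P.omega x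
    + 2 * lam * ∑ x ∈ P.points, ‖phiPlus P lam x‖ ^ 2 * P.v x

/-- The normalized eigenfunction `φ₊(λ, x) / √(λ γ_λ²)` of an eigenvalue `λ`. -/
def normalizedEigenfunction (P : DiscretePair) (lam : ℝ) (x : ℝ) : ℂ :=
  phiPlus P lam x / (Real.sqrt (lam * gammaSq P lam) : ℂ)

/-- `{λ_i, φ_i(a)}` is the interior spectral data at `a` of the pair `P`: the `λ_i`, listed in
increasing order, are exactly the eigenvalues, and `φ_i(a)` is the value at `a` of the
normalized eigenfunction of `λ_i`. -/
structure IsInteriorSpectralData (P : DiscretePair) (a : ℝ) {N : ℕ} (lam phi : Fin N → ℝ) :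
    Prop where
  strictMono : StrictMono lam
  spec_eq : spec P = Set.range (fun i => (lam i : ℂ))
  value : ∀ i, (phi i : ℂ) = normalizedEigenfunction P (lam i) a

/-- The left derivative `f'(x) = f'(x-)`. -/
def leftDeriv (f : ℝ → ℂ) (x : ℝ) : ℂ := derivWithin f (Set.Iic x) x

/-- The Weyl–Titchmarsh function `M₊(z, a)`. -/
def weylPlus (P : DiscretePair) (a : ℝ) (z : ℂ) : ℂ :=
  leftDeriv (phiPlus P z) a / (z * phiPlus P z a)

/-- The Weyl–Titchmarsh function `M₋(z, a)`. -/
def weylMinus (P : DiscretePair) (a : ℝ) (z : ℂ) : ℂ :=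
  -(leftDeriv (phiMinus P z) a / (z * phiMinus P z a))

/-- `G(z) = ∑ λ_i² |φ_i(a)|² / (λ_i - z)`, computed from the data. -/
def dataG {N : ℕ} (lam phi : Fin N → ℝ) (z : ℂ) : ℂ :=
  ∑ i, ((lam i ^ 2 * |phi i| ^ 2 : ℝ) : ℂ) / (lam i - z)

/-- The nonzero zeros `μ` of `G` that lie strictly between two consecutive `λ_j < λ_{j+1}` with
`φ_j(a) φ_{j+1}(a) > 0`. -/
def dataPolesMinus {N : ℕ} (lam phi : Fin N → ℝ) : Set ℝ :=
  {μ | μ ≠ 0 ∧ dataG lam phi μ = 0 ∧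
    ∃ i j : Fin N, (j : ℕ) = i + 1 ∧ lam i < μ ∧ μ < lam j ∧ 0 < phi i * phi j}

/-- The function `M₋` computed from the data: it has the pole `0` with residue `-1/2`, and its
other poles are the `μ` in `dataPolesMinus`, with the residues of `-1 / G` there. -/
def dataMinus {N : ℕ} (lam phi : Fin N → ℝ) (z : ℂ) : ℂ :=
  -1 / (2 * z) + ∑ᶠ μ ∈ dataPolesMinus lam phi, (1 / deriv (dataG lam phi) (μ : ℂ)) / ((μ : ℂ) - z)

/-- The function `M₊` computed from the data, so that `M₊ + M₋ = -1 / G`. -/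
def dataPlus {N : ℕ} (lam phi : Fin N → ℝ) (z : ℂ) : ℂ :=
  -1 / dataG lam phi z - dataMinus lam phi z

/-- `P` is a pair reconstructed at `a` from the data: its Weyl–Titchmarsh functions at `a`
are the functions computed from the data. -/
def IsReconstruction (P : DiscretePair) (a : ℝ) {N : ℕ} (lam phi : Fin N → ℝ) : Prop :=
  ∀ z : ℂ, z.im ≠ 0 →
    weylPlus P a z = dataPlus lam phi z ∧ weylMinus P a z = dataMinus lam phi z

end Peakon

end

/-!
The existence of a pair is part of the hypotheses, so two things have to be shown: a pair `P` with
the given data has the Weyl–Titchmarsh functions computed from the data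
(`IsBalancedData.isReconstruction`), and these functions determine a pair
(`IsReconstruction.unique`).

Between the point masses a solution is `c₁ e^{-x/2} + c₂ e^{x/2}`, and Green's identity
(`IsJumpSolution.wronskian_sub`) shows how `c₁` and `c₂` jump at each mass.  Hence for `φ₋` they are
real polynomials in `z`, obtained by the recursion `transfer` along the list of masses to the left;
`φ₊` is treated by reflection.  Value and derivative of `φ_±` at `a`, and the Wronskian `W`, are
therefore polynomials in `z`, and `transfer_degree` gives their behaviour at `z = ∞`: the ratio
`-c₁ / c₂` tends to `e^b`, where `b` is the last mass passed, and to `0` if there is none.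

*Uniqueness.*  `M_±(·, a)` fixes the ratio `c₁ / c₂`.  Its limit at `∞` gives the position of the
mass nearest to `a`; the weight of that mass is a polynomial in `z` without constant term, and it is
the unbounded part of the logarithmic derivative there; so the mass can be removed, and induction
finishes the argument (`eq_of_transfer_mul_eq`, `eq_of_weyl_eq`).

*Reconstruction.*  The zeros of `W` are the eigenvalues (`mem_spec_iff`), and Green's identity for
`φ₊(w, ·)` and `φ₋(z, ·)` gives `W'(λ) = -c γ_λ²` where `φ₋ = c φ₊` (`exists_proportionality`).  As
`φ_i(a) ≠ 0`, all `λ_i γ_i²` are positive, so the zeros of `W` are simple, and expanding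
`φ₊ φ₋ / (z W)` in partial fractions yields `z φ₊(z, a) φ₋(z, a) / W(z) = α z + β + G(z) = G(z)`
(`IsBalancedData.aeval_eq_mul_dataG`).  This is `-1 / (M₊ + M₋) = G`.  Since `G` is a Herglotz
function, its zeros are real and simple, at most one in each gap between eigenvalues.  Therefore
`M₋ = -φ₋' / (z φ₋)` has simple poles, with residue `-1/2` at `0` and the residues of `-1 / G`
elsewhere.  Whether a zero `μ ≠ 0` of `G` in a gap belongs to `φ₋` or to `φ₊` is read off from the
signs of `φ₊` at the ends of the gap (`IsBalancedData.mem_dataPolesMinus_iff`).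
-/

namespace Peakon

/-! ### Left derivatives and Green's identity -/

namespace IsJumpSolution

variable {S : Finset ℝ} {k : ℝ → ℂ} {f : ℝ → ℂ}

theorem eventually_differentiableAt_left (h : IsJumpSolution S k f) (x : ℝ) :
    ∀ᶠ y in 𝓝[<] x, DifferentiableAt ℝ f y := by
  filter_upwards [eventually_not_mem_left S x] with y hy using h.differentiableAt y hy

theorem leftDeriv_eq_of_tendsto (h : IsJumpSolution S k f) {x : ℝ} {l : ℂ}
    (hl : Tendsto (deriv f) (𝓝[<] x) (𝓝 l)) : leftDeriv f x = l := by
  have h1 : HasDerivWithinAt f l (Set.Iic x) x := by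
    refine hasDerivWithinAt_Iic_of_tendsto_deriv (s := {y | DifferentiableAt ℝ f y})
      (fun y hy => DifferentiableAt.differentiableWithinAt hy)
      h.continuous.continuousWithinAt (h.eventually_differentiableAt_left x) hl
  exact h1.derivWithin (uniqueDiffWithinAt_Iic x)

theorem leftDeriv_of_not_mem (h : IsJumpSolution S k f) {x : ℝ} (hx : x ∉ S) :
    leftDeriv f x = deriv f x :=
  (h.differentiableAt x hx).derivWithin (uniqueDiffWithinAt_Iic x)

theorem tendsto_leftDeriv_left (h : IsJumpSolution S k f) (x : ℝ) :
    Tendsto (leftDeriv f) (𝓝[<] x) (𝓝 (leftDeriv f x)) := by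
  have h1 : Tendsto (deriv f) (𝓝[<] x) (𝓝 (leftDeriv f x)) := by
    by_cases hx : x ∈ S
    · obtain ⟨l, r, hl, -, -⟩ := h.jump x hx
      rwa [h.leftDeriv_eq_of_tendsto hl]
    · rw [h.leftDeriv_of_not_mem hx]
      exact (h.deriv_tendsto_of_not_mem hx).mono_left nhdsWithin_le_nhds
  refine h1.congr' ?_
  filter_upwards [eventually_not_mem_left S x] with y hy using (h.leftDeriv_of_not_mem hy).symm

theorem tendsto_leftDeriv_right (h : IsJumpSolution S k f) (x : ℝ) :
    Tendsto (leftDeriv f) (𝓝[>] x) (𝓝 (leftDeriv f x - if x ∈ S then k x * f x else 0)) := by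
  have h1 : Tendsto (deriv f) (𝓝[>] x)
      (𝓝 (leftDeriv f x - if x ∈ S then k x * f x else 0)) := by
    by_cases hx : x ∈ S
    · obtain ⟨l, r, hl, hr, hlr⟩ := h.jump x hx
      rw [h.leftDeriv_eq_of_tendsto hl, hlr]
      simpa [hx] using hr
    · rw [h.leftDeriv_of_not_mem hx]
      simpa [hx] using (h.deriv_tendsto_of_not_mem hx).mono_left nhdsWithin_le_nhds
  refine h1.congr' ?_
  filter_upwards [eventually_not_mem_right S x] with y hy using (h.leftDeriv_of_not_mem hy).symm

end IsJumpSolution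

/-- The Wronskian `f g' - f' g`, formed with the left derivatives. -/
noncomputable def wronskian (f g : ℝ → ℂ) (x : ℝ) : ℂ :=
  f x * leftDeriv g x - leftDeriv f x * g x

theorem eq_of_continuous_of_hasDerivAt_zero {S : Finset ℝ} {u : ℝ → ℂ} (hc : Continuous u)
    (hd : ∀ x ∉ S, HasDerivAt u 0 x) (x y : ℝ) : u x = u y := by
  have h := MeasureTheory.integral_eq_of_hasDerivAt_off_countable u (fun _ => (0 : ℂ))
    (a := x) (b := y) S.countable_toSet hc.continuousOn (fun t ht => hd t (by simpa using ht.2))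
    (by simp)
  simp only [intervalIntegral.integral_zero] at h
  exact (sub_eq_zero.1 h.symm).symm

/-- Green's identity: the Wronskian of solutions for two systems of weights jumps by
`(k₁ - k₂) f g` at every point mass and is constant in between. -/
theorem IsJumpSolution.wronskian_sub_sum_eq {S : Finset ℝ} {k₁ k₂ : ℝ → ℂ} {f g : ℝ → ℂ}
    (hf : IsJumpSolution S k₁ f) (hg : IsJumpSolution S k₂ g) (x y : ℝ) :
    wronskian f g x - ∑ s ∈ S, (if s < x then (k₁ s - k₂ s) * f s * g s else 0) =
      wronskian f g y - ∑ s ∈ S, (if s < y then (k₁ s - k₂ s) * f s * g s else 0) := by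
  set J : ℝ → ℂ := fun s => (k₁ s - k₂ s) * f s * g s
  -- after subtraction of its jumps the Wronskian is continuous, with derivative `0` off `S`
  refine eq_of_continuous_of_hasDerivAt_zero (S := S)
    (u := fun x => wronskian f g x - ∑ s ∈ S, (if s < x then J s else 0)) ?_ ?_ x y
  · rw [continuous_iff_continuousAt]
    intro x
    rw [continuousAt_iff_continuous_left'_right']
    constructor
    · refine Tendsto.sub ?_ ?_
      · exact (((hf.continuous.continuousWithinAt (s := Set.Iio x)).tendsto).mul
          (hg.tendsto_leftDeriv_left x)).sub ((hf.tendsto_leftDeriv_left x).mul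
            (hg.continuous.continuousWithinAt (s := Set.Iio x)).tendsto)
      · refine tendsto_finsetSum _ fun s _ => tendsto_const_nhds.congr' ?_
        by_cases hs : s < x
        · filter_upwards [Ioo_mem_nhdsLT hs] with y hy
          simp [hs, hy.1]
        · filter_upwards [self_mem_nhdsWithin] with y hy
          have : ¬ s < y := fun h => hs (h.trans hy)
          simp [hs, this]
    · have h1 : Tendsto (wronskian f g) (𝓝[>] x)
          (𝓝 (wronskian f g x + if x ∈ S then J x else 0)) := by
        have := (((hf.continuous.continuousWithinAt (s := Set.Ioi x)).tendsto).mul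
          (hg.tendsto_leftDeriv_right x)).sub ((hf.tendsto_leftDeriv_right x).mul
            (hg.continuous.continuousWithinAt (s := Set.Ioi x)).tendsto)
        have e : (wronskian f g x + if x ∈ S then J x else 0) =
            f x * (leftDeriv g x - if x ∈ S then k₂ x * g x else 0) -
              (leftDeriv f x - if x ∈ S then k₁ x * f x else 0) * g x := by
          by_cases hx : x ∈ S
          · simp only [hx, if_true, wronskian, J]; ring
          · simp only [hx, if_false, wronskian]; ring
        rw [e]
        exact this
      have h2 : Tendsto (fun y => ∑ s ∈ S, (if s < y then J s else 0)) (𝓝[>] x)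
          (𝓝 (∑ s ∈ S, (if s ≤ x then J s else 0))) := by
        refine tendsto_finsetSum _ fun s _ => tendsto_const_nhds.congr' ?_
        by_cases hs : s ≤ x
        · filter_upwards [self_mem_nhdsWithin] with y hy
          have : s < y := hs.trans_lt hy
          simp [hs, this]
        · filter_upwards [Ioo_mem_nhdsGT (not_le.1 hs)] with y hy
          simp [hs, hy.2.le]
      have h3 : ∑ s ∈ S, (if s ≤ x then J s else 0) =
          ∑ s ∈ S, (if s < x then J s else 0) + if x ∈ S then J x else 0 := by
        rw [← Finset.sum_ite_eq' S x J, ← Finset.sum_add_distrib]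
        refine Finset.sum_congr rfl fun s _ => ?_
        rcases lt_trichotomy s x with h | h | h
        · simp [h, h.le, h.ne]
        · simp [h]
        · simp [not_le.2 h, h.ne', not_lt.2 h.le]
      have h4 := h1.sub h2
      rw [h3] at h4
      change Tendsto _ _ _
      convert h4 using 2
      ring
  · intro x hx
    have hV : HasDerivAt (wronskian f g) 0 x := by
      have h1 : HasDerivAt (fun x => f x * deriv g x - deriv f x * g x) 0 x := by
        refine (((hf.differentiableAt x hx).hasDerivAt.mul (hg.ode x hx)).sub
          ((hf.ode x hx).mul (hg.differentiableAt x hx).hasDerivAt)).congr_deriv ?_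
        ring
      refine h1.congr_of_eventuallyEq ?_
      have : ((S : Set ℝ))ᶜ ∈ 𝓝 x :=
        S.finite_toSet.isClosed.isOpen_compl.mem_nhds (by simpa using hx)
      filter_upwards [this] with y hy
      have hy' : y ∉ S := by simpa using hy
      simp [wronskian, hf.leftDeriv_of_not_mem hy', hg.leftDeriv_of_not_mem hy']
    have hs : HasDerivAt (fun y => ∑ s ∈ S, (if s < y then J s else 0)) (∑ s ∈ S, (0 : ℂ)) x := by
      refine HasDerivAt.fun_sum fun s hs => ?_
      have hne : s ≠ x := fun h => hx (h ▸ hs)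
      refine (hasDerivAt_const x (if s < x then J s else 0)).congr_of_eventuallyEq ?_
      rcases lt_or_gt_of_ne hne with h | h
      · filter_upwards [Ioi_mem_nhds h] with y hy
        simp [h, Set.mem_Ioi.1 hy]
      · filter_upwards [Iio_mem_nhds h] with y hy
        simp [not_lt.2 h.le, not_lt.2 (Set.mem_Iio.1 hy).le]
    exact (hV.sub hs).congr_deriv (by simp)

/-- Green's identity between two points. -/
theorem IsJumpSolution.wronskian_sub {S : Finset ℝ} {k₁ k₂ : ℝ → ℂ} {f g : ℝ → ℂ}
    (hf : IsJumpSolution S k₁ f) (hg : IsJumpSolution S k₂ g) {x y : ℝ} (hxy : x ≤ y) :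
    wronskian f g y - wronskian f g x =
      ∑ s ∈ S with x ≤ s ∧ s < y, (k₁ s - k₂ s) * f s * g s := by
  have h := hf.wronskian_sub_sum_eq hg x y
  have h2 : ∑ s ∈ S with x ≤ s ∧ s < y, (k₁ s - k₂ s) * f s * g s =
      ∑ s ∈ S, (if s < y then (k₁ s - k₂ s) * f s * g s else 0)
       - ∑ s ∈ S, (if s < x then (k₁ s - k₂ s) * f s * g s else 0) := by
    rw [Finset.sum_filter, ← Finset.sum_sub_distrib]
    refine Finset.sum_congr rfl fun s _ => ?_
    by_cases h1 : s < x
    · simp [h1, h1.trans_le hxy, not_le.2 h1]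
    · by_cases h2 : s < y <;> simp [h1, h2, not_lt.1 h1]
  rw [h2]; linear_combination -h

theorem IsJumpSolution.wronskian_eq {S : Finset ℝ} {k : ℝ → ℂ} {f g : ℝ → ℂ}
    (hf : IsJumpSolution S k f) (hg : IsJumpSolution S k g) (x y : ℝ) :
    wronskian f g x = wronskian f g y := by
  simpa using hf.wronskian_sub_sum_eq hg x y

/-! ### Coefficients with respect to the exponentials -/

theorem hasDerivAt_cexp_mul (c : ℂ) (x : ℝ) :
    HasDerivAt (fun x : ℝ => Complex.exp (c * x)) (c * Complex.exp (c * x)) x := by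
  have := (((hasDerivAt_id (x : ℂ)).const_mul c).cexp).comp_ofReal
  exact this.congr_deriv (by simp only [id]; ring)

theorem leftDeriv_eq_of_hasDerivAt {f : ℝ → ℂ} {f' : ℂ} {x : ℝ} (h : HasDerivAt f f' x) :
    leftDeriv f x = f' :=
  h.hasDerivWithinAt.derivWithin (uniqueDiffWithinAt_Iic x)

theorem isJumpSolution_cexp (S : Finset ℝ) {c : ℂ} (hc : c ^ 2 = 1 / 4) :
    IsJumpSolution S (fun _ => 0) (fun x : ℝ => Complex.exp (c * x)) := by
  have hd : deriv (fun x : ℝ => Complex.exp (c * x)) = fun x : ℝ => c * Complex.exp (c * x) :=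
    funext fun x => (hasDerivAt_cexp_mul c x).deriv
  have hcont : Continuous (fun x : ℝ => c * Complex.exp (c * x)) := by fun_prop
  refine ⟨by fun_prop, fun x _ => (hasDerivAt_cexp_mul c x).differentiableAt, fun x _ => ?_,
    fun s _ =>
    ⟨c * Complex.exp (c * s), c * Complex.exp (c * s), ?_, ?_, ?_⟩⟩
  · rw [hd]
    refine ((hasDerivAt_cexp_mul c x).const_mul c).congr_deriv ?_
    linear_combination Complex.exp (c * x) * hc
  · rw [hd]; exact hcont.continuousAt.mono_left nhdsWithin_le_nhds
  · rw [hd]; exact hcont.continuousAt.mono_left nhdsWithin_le_nhds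
  · simp

/-- The coefficient of `e^{-x/2}` of a function `f` that solves `f'' = f / 4` to the left of `x`:
`f = coeffDecay · e^{-x/2} + coeffGrowth · e^{x/2}`. -/
noncomputable def coeffDecay (f : ℝ → ℂ) (x : ℝ) : ℂ :=
  (f x / 2 - leftDeriv f x) * Complex.exp ((1 / 2 : ℂ) * x)

/-- The coefficient of `e^{x/2}` of a function `f` that solves `f'' = f / 4` to the left of `x`. -/
noncomputable def coeffGrowth (f : ℝ → ℂ) (x : ℝ) : ℂ :=
  (f x / 2 + leftDeriv f x) * Complex.exp ((-1 / 2 : ℂ) * x)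

theorem cexp_mul_cexp_neg (x : ℂ) :
    Complex.exp ((1 / 2 : ℂ) * x) * Complex.exp ((-1 / 2 : ℂ) * x) = 1 := by
  rw [← Complex.exp_add, show (1 / 2 : ℂ) * x + (-1 / 2 : ℂ) * x = 0 by ring, Complex.exp_zero]

theorem eq_coeff_combination (f : ℝ → ℂ) (x : ℝ) :
    f x = coeffDecay f x * Complex.exp ((-1 / 2 : ℂ) * x)
      + coeffGrowth f x * Complex.exp ((1 / 2 : ℂ) * x) := by
  have := cexp_mul_cexp_neg x
  simp only [coeffDecay, coeffGrowth]
  linear_combination (-f x) * this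

theorem leftDeriv_eq_coeff_combination (f : ℝ → ℂ) (x : ℝ) :
    leftDeriv f x = (coeffGrowth f x * Complex.exp ((1 / 2 : ℂ) * x)
      - coeffDecay f x * Complex.exp ((-1 / 2 : ℂ) * x)) / 2 := by
  have := cexp_mul_cexp_neg x
  simp only [coeffDecay, coeffGrowth]
  linear_combination (-leftDeriv f x) * this

theorem coeffDecay_eq_wronskian (f : ℝ → ℂ) (x : ℝ) :
    coeffDecay f x = wronskian f (fun x : ℝ => Complex.exp ((1 / 2 : ℂ) * x)) x := by
  simp only [coeffDecay, wronskian, leftDeriv_eq_of_hasDerivAt (hasDerivAt_cexp_mul (1 / 2) x)]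
  ring

theorem coeffGrowth_eq_wronskian (f : ℝ → ℂ) (x : ℝ) :
    coeffGrowth f x = -wronskian f (fun x : ℝ => Complex.exp ((-1 / 2 : ℂ) * x)) x := by
  simp only [coeffGrowth, wronskian, leftDeriv_eq_of_hasDerivAt (hasDerivAt_cexp_mul (-1 / 2) x)]
  ring

namespace IsJumpSolution

variable {S : Finset ℝ} {k : ℝ → ℂ} {f g : ℝ → ℂ}

theorem coeffDecay_sub (h : IsJumpSolution S k f) {x y : ℝ} (hxy : x ≤ y) :
    coeffDecay f y - coeffDecay f x =
      ∑ s ∈ S with x ≤ s ∧ s < y, k s * f s * Complex.exp ((1 / 2 : ℂ) * s) := by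
  rw [coeffDecay_eq_wronskian, coeffDecay_eq_wronskian,
    h.wronskian_sub (isJumpSolution_cexp S (c := 1 / 2) (by norm_num)) hxy]
  simp

theorem coeffGrowth_sub (h : IsJumpSolution S k f) {x y : ℝ} (hxy : x ≤ y) :
    coeffGrowth f y - coeffGrowth f x =
      -∑ s ∈ S with x ≤ s ∧ s < y, k s * f s * Complex.exp ((-1 / 2 : ℂ) * s) := by
  have := h.wronskian_sub (isJumpSolution_cexp S (c := -1 / 2) (by norm_num)) hxy
  simp only [sub_zero] at this
  rw [coeffGrowth_eq_wronskian, coeffGrowth_eq_wronskian, ← this]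
  ring

theorem coeff_eq_of_no_points (h : IsJumpSolution S k f) {x y : ℝ} (hxy : x ≤ y)
    (hS : ∀ s ∈ S, ¬ (x ≤ s ∧ s < y)) :
    coeffDecay f y = coeffDecay f x ∧ coeffGrowth f y = coeffGrowth f x := by
  have h1 := h.coeffDecay_sub hxy
  have h2 := h.coeffGrowth_sub hxy
  rw [Finset.filter_false_of_mem hS, Finset.sum_empty] at h1 h2
  exact ⟨by linear_combination h1, by linear_combination h2⟩

theorem const_mul (h : IsJumpSolution S k f) (c : ℂ) :
    IsJumpSolution S k (fun x => c * f x) := by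
  have hd : deriv (fun x => c * f x) = fun x => c * deriv f x :=
    funext fun x => deriv_const_mul_field c
  refine ⟨h.continuous.const_mul c, fun x hx => (h.differentiableAt x hx).const_mul c,
    fun x hx => ?_, fun s hs => ?_⟩
  · rw [hd]
    exact ((h.ode x hx).const_mul c).congr_deriv (by ring)
  · obtain ⟨l, r, hl, hr, hlr⟩ := h.jump s hs
    exact ⟨c * l, c * r, by rw [hd]; exact hl.const_mul c, by rw [hd]; exact hr.const_mul c,
      by rw [hlr]; ring⟩

theorem eq_of_eventually_atTop (hf : IsJumpSolution S k f) (hg : IsJumpSolution S k g)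
    (h : ∀ᶠ x in atTop, f x = g x) : f = g := by
  have := (hf.sub hg).eq_zero_of_eventually (by
    filter_upwards [h] with x hx using sub_eq_zero.2 hx)
  funext x
  exact sub_eq_zero.1 (congrFun this x)

theorem eventually_atTop_coeff (h : IsJumpSolution S k f) :
    ∃ A B : ℂ, ∀ᶠ x in atTop, coeffDecay f x = A ∧ coeffGrowth f x = B := by
  obtain ⟨b, hb⟩ := S.bddAbove
  refine ⟨coeffDecay f (b + 1), coeffGrowth f (b + 1), ?_⟩
  filter_upwards [eventually_ge_atTop (b + 1)] with x hx
  exact h.coeff_eq_of_no_points hx fun s hs hh => by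
    have := hb hs; linarith [hh.1]

/-- A bounded solution is a multiple of every solution that equals `e^{-x/2}` near `+∞`. -/
theorem exists_eq_mul_of_bounded (h : IsJumpSolution S k f) (hg : IsJumpSolution S k g)
    (hge : ∀ᶠ x in atTop, g x = Complex.exp (-(x : ℂ) / 2)) {C : ℝ} (hC : ∀ x, ‖f x‖ ≤ C) :
    ∃ A : ℂ, f = fun x => A * g x := by
  obtain ⟨A, B, hAB⟩ := h.eventually_atTop_coeff
  have hf : ∀ᶠ x : ℝ in atTop, f x = A * Complex.exp ((-1 / 2 : ℂ) * x)
      + B * Complex.exp ((1 / 2 : ℂ) * x) := by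
    filter_upwards [hAB] with x hx
    rw [← hx.1, ← hx.2]; exact eq_coeff_combination f x
  have hB : B = 0 := by
    by_contra hB
    have h1 : Tendsto (fun x : ℝ => ‖B‖ * Real.exp ((1 / 2) * x)) atTop atTop :=
      (Real.tendsto_exp_atTop.comp (tendsto_id.const_mul_atTop (by norm_num))).const_mul_atTop
        (norm_pos_iff.2 hB)
    obtain ⟨x, hx1, hx2, hx3⟩ := (hf.and ((h1.eventually_gt_atTop (C + ‖A‖)).and
      (eventually_ge_atTop 0))).exists
    have e1 : ‖Complex.exp ((1 / 2 : ℂ) * x)‖ = Real.exp ((1 / 2) * x) := by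
      rw [show (1 / 2 : ℂ) * x = ((1 / 2 * x : ℝ) : ℂ) by push_cast; ring,
        Complex.norm_exp_ofReal]
    have e2 : ‖Complex.exp ((-1 / 2 : ℂ) * x)‖ ≤ 1 := by
      rw [show (-1 / 2 : ℂ) * x = ((-1 / 2 * x : ℝ) : ℂ) by push_cast; ring,
        Complex.norm_exp_ofReal]
      exact Real.exp_le_one_iff.2 (by linarith)
    have e3 : B * Complex.exp ((1 / 2 : ℂ) * x) = f x - A * Complex.exp ((-1 / 2 : ℂ) * x) := by
      rw [hx1]; ring
    have e4 : ‖B * Complex.exp ((1 / 2 : ℂ) * x)‖ ≤ C + ‖A‖ := by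
      rw [e3]
      refine (norm_sub_le _ _).trans (add_le_add (hC x) ?_)
      rw [norm_mul]
      exact mul_le_of_le_one_right (norm_nonneg _) e2
    rw [norm_mul, e1] at e4
    linarith
  refine ⟨A, h.eq_of_eventually_atTop (hg.const_mul A) ?_⟩
  filter_upwards [hf, hge] with x h1 h2
  rw [h1, h2, hB]
  rw [show (-1 / 2 : ℂ) * x = -(x : ℂ) / 2 by ring]; ring

end IsJumpSolution

open Polynomial

/-! ### The transfer recursion -/

/-- The polynomials `(E₁, E₂)` in `z` such that the solution equal to `e^{x/2}` near `-∞` is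
`E₁ e^{-x/2} + E₂ e^{x/2}` between the point masses in `L` and the next one to the right.  The list
`L` is decreasing and `K s` is the weight at `s`, a polynomial in `z`. -/
noncomputable def transfer (K : ℝ → ℝ[X]) : List ℝ → ℝ[X] × ℝ[X]
  | [] => (0, 1)
  | b :: L =>
    let E := transfer K L
    let F := C (Real.exp (-b / 2)) * E.1 + C (Real.exp (b / 2)) * E.2
    (E.1 + C (Real.exp (b / 2)) * (K b * F), E.2 - C (Real.exp (-b / 2)) * (K b * F))

/-- The value at `x` of the function with coefficients `E`. -/
noncomputable def valuePoly (x : ℝ) (E : ℝ[X] × ℝ[X]) : ℝ[X] :=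
  C (Real.exp (-x / 2)) * E.1 + C (Real.exp (x / 2)) * E.2

/-- The derivative at `x` of the function with coefficients `E`. -/
noncomputable def slopePoly (x : ℝ) (E : ℝ[X] × ℝ[X]) : ℝ[X] :=
  C (1 / 2) * (C (Real.exp (x / 2)) * E.2 - C (Real.exp (-x / 2)) * E.1)

/-- The ratio `-E₁ / E₂` at `z = ∞`: it is `e^b` for the first point `b` of the list, and `0` for
the empty list. -/
noncomputable def headExp : List ℝ → ℝ
  | [] => 0
  | b :: _ => Real.exp b

theorem headExp_nonneg (L : List ℝ) : 0 ≤ headExp L := by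
  cases L
  · exact le_rfl
  · exact (Real.exp_pos _).le

theorem headExp_lt {L : List ℝ} {x : ℝ} (h : ∀ s ∈ L, s < x) : headExp L < Real.exp x := by
  cases L
  · exact Real.exp_pos _
  · exact Real.exp_lt_exp.2 (h _ (by simp))

theorem headExp_le {L : List ℝ} {x : ℝ} (h : ∀ s ∈ L, s ≤ x) : headExp L ≤ Real.exp x := by
  cases L
  · exact (Real.exp_pos _).le
  · exact Real.exp_le_exp.2 (h _ (by simp))

theorem exp_half_mul_exp_neg_half (b : ℝ) : Real.exp (b / 2) * Real.exp (-b / 2) = 1 := by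
  rw [← Real.exp_add, show b / 2 + -b / 2 = 0 by ring, Real.exp_zero]

theorem exp_half_mul_exp_half (b : ℝ) : Real.exp (b / 2) * Real.exp (b / 2) = Real.exp b := by
  rw [← Real.exp_add, show b / 2 + b / 2 = b by ring]

theorem transfer_cons (K : ℝ → ℝ[X]) (b : ℝ) (L : List ℝ) :
    transfer K (b :: L) =
     ((transfer K L).1 + C (Real.exp (b / 2)) * (K b * valuePoly b (transfer K L)),
      (transfer K L).2 - C (Real.exp (-b / 2)) * (K b * valuePoly b (transfer K L))) := rfl

theorem C_exp_half_mul (b : ℝ) :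
    (C (Real.exp (b / 2)) * C (Real.exp (-b / 2)) : ℝ[X]) = 1 := by
  rw [← C_mul, exp_half_mul_exp_neg_half, C_1]

theorem valuePoly_transfer_cons (K : ℝ → ℝ[X]) (b : ℝ) (L : List ℝ) :
    valuePoly b (transfer K (b :: L)) = valuePoly b (transfer K L) := by
  have := C_exp_half_mul b
  rw [transfer_cons]
  simp only [valuePoly]
  ring

theorem slopePoly_transfer_cons (K : ℝ → ℝ[X]) (b : ℝ) (L : List ℝ) :
    slopePoly b (transfer K (b :: L)) =
      slopePoly b (transfer K L) - K b * valuePoly b (transfer K L) := by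
  have h := C_exp_half_mul b
  have h2 : (C (1 / 2) * 2 : ℝ[X]) = 1 := by
    rw [show (2 : ℝ[X]) = C 2 from rfl, ← C_mul]; norm_num
  rw [transfer_cons]
  simp only [slopePoly]
  linear_combination (-C (1 / 2) * 2 * (K b * valuePoly b (transfer K L))) * h
    - (K b * valuePoly b (transfer K L)) * h2

/-- Proportionality of value and slope at a point is proportionality of the coefficients. -/
theorem valuePoly_mul_slopePoly_sub (x : ℝ) (E E' : ℝ[X] × ℝ[X]) :
    valuePoly x E * slopePoly x E' - slopePoly x E * valuePoly x E' =
      E.1 * E'.2 - E.2 * E'.1 := by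
  have h := C_exp_half_mul x
  have h2 : (C (1 / 2) * 2 : ℝ[X]) = 1 := by
    rw [show (2 : ℝ[X]) = C 2 from rfl, ← C_mul]; norm_num
  simp only [slopePoly, valuePoly]
  linear_combination (C (1 / 2) * 2 * (E.1 * E'.2 - E.2 * E'.1)) * h
    + (E.1 * E'.2 - E.2 * E'.1) * h2

/-- The sum of the degrees of the weights. -/
noncomputable def totalDegree (K : ℝ → ℝ[X]) (L : List ℝ) : ℕ :=
  (L.map fun s => (K s).natDegree).sum

/-- The weights are nonzero polynomials without constant term. -/
def NontrivialWeights (K : ℝ → ℝ[X]) (L : List ℝ) : Prop := ∀ s ∈ L, K s ≠ 0 ∧ (K s).coeff 0 = 0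

theorem natDegree_pos_of_coeff_zero {p : ℝ[X]} (hp : p ≠ 0) (h0 : p.coeff 0 = 0) :
    0 < p.natDegree := by
  rw [Nat.pos_iff_ne_zero]
  intro h
  rw [eq_C_of_natDegree_eq_zero h, h0, C_0] at hp
  exact hp rfl

theorem coeff_mul_of_le {p q : ℝ[X]} {m n : ℕ} (hp : p.natDegree ≤ m) (hq : q.natDegree ≤ n) :
    (p * q).coeff (m + n) = p.coeff m * q.coeff n := by
  exact coeff_mul_add_eq_of_natDegree_le hp hq

theorem natDegree_sub_le_of_both_le {p q : ℝ[X]} {d : ℕ} (hp : p.natDegree ≤ d)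
    (hq : q.natDegree ≤ d) : (p - q).natDegree ≤ d :=
  (natDegree_sub_le_of_le hp hq).trans (max_self d).le

theorem natDegree_valuePoly_le {x : ℝ} {E : ℝ[X] × ℝ[X]} {d : ℕ} (h1 : E.1.natDegree ≤ d)
    (h2 : E.2.natDegree ≤ d) : (valuePoly x E).natDegree ≤ d :=
  (natDegree_add_le_of_degree_le ((natDegree_C_mul_le _ _).trans h1)
    ((natDegree_C_mul_le _ _).trans h2))

theorem natDegree_slopePoly_le {x : ℝ} {E : ℝ[X] × ℝ[X]} {d : ℕ} (h1 : E.1.natDegree ≤ d)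
    (h2 : E.2.natDegree ≤ d) : (slopePoly x E).natDegree ≤ d :=
  (natDegree_C_mul_le _ _).trans
    ((natDegree_sub_le_of_both_le ((natDegree_C_mul_le _ _).trans h2)
      ((natDegree_C_mul_le _ _).trans h1)))

theorem coeff_valuePoly {x r : ℝ} {E : ℝ[X] × ℝ[X]} {d : ℕ}
    (h : E.1.coeff d = -r * E.2.coeff d) :
    (valuePoly x E).coeff d = E.2.coeff d * Real.exp (-x / 2) * (Real.exp x - r) := by
  have h1 := exp_half_mul_exp_neg_half x
  have h2 := exp_half_mul_exp_half x
  simp only [valuePoly, coeff_add, coeff_C_mul, h]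
  linear_combination (-E.2.coeff d * Real.exp (x / 2)) * h1 + E.2.coeff d * Real.exp (-x / 2) * h2

theorem coeff_valuePoly_ne_zero {x r : ℝ} {E : ℝ[X] × ℝ[X]} {d : ℕ}
    (h : E.1.coeff d = -r * E.2.coeff d) (h2 : E.2.coeff d ≠ 0) (hr : r < Real.exp x) :
    (valuePoly x E).coeff d ≠ 0 := by
  rw [coeff_valuePoly h]
  exact mul_ne_zero (mul_ne_zero h2 (Real.exp_pos _).ne') (sub_pos.2 hr).ne'

/-- The behaviour of the coefficients at `z = ∞`. -/
theorem transfer_degree {K : ℝ → ℝ[X]} {L : List ℝ} (hL : L.Pairwise (· > ·))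
    (hK : NontrivialWeights K L) :
    (transfer K L).1.natDegree ≤ totalDegree K L ∧ (transfer K L).2.natDegree ≤ totalDegree K L ∧
    (transfer K L).2.coeff (totalDegree K L) ≠ 0 ∧
    (transfer K L).1.coeff (totalDegree K L) =
      -headExp L * (transfer K L).2.coeff (totalDegree K L) := by
  induction L with
  | nil => simp [transfer, totalDegree, headExp]
  | cons b L ih =>
    rw [List.pairwise_cons] at hL
    obtain ⟨i1, i2, i3, i4⟩ := ih hL.2 (fun s hs => hK s (by simp [hs]))
    obtain ⟨hb, hb0⟩ := hK b (by simp)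
    have hpos := natDegree_pos_of_coeff_zero hb hb0
    have hd : totalDegree K (b :: L) = (K b).natDegree + totalDegree K L := by
      simp [totalDegree]
    set d := totalDegree K L
    set F := valuePoly b (transfer K L) with hF
    have hFd : F.natDegree ≤ d := natDegree_valuePoly_le i1 i2
    have hFc : F.coeff d ≠ 0 := coeff_valuePoly_ne_zero i4 i3 (headExp_lt hL.1)
    have hKF : (K b * F).natDegree ≤ (K b).natDegree + d := natDegree_mul_le_of_le le_rfl hFd
    have hKFc : (K b * F).coeff ((K b).natDegree + d) = (K b).leadingCoeff * F.coeff d :=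
      coeff_mul_of_le le_rfl hFd
    have z1 : (transfer K L).1.coeff ((K b).natDegree + d) = 0 :=
      coeff_eq_zero_of_natDegree_lt (by omega)
    have z2 : (transfer K L).2.coeff ((K b).natDegree + d) = 0 :=
      coeff_eq_zero_of_natDegree_lt (by omega)
    rw [hd, transfer_cons]
    refine ⟨natDegree_add_le_of_degree_le (by omega) ((natDegree_C_mul_le _ _).trans hKF),
      natDegree_sub_le_of_both_le (by omega) ((natDegree_C_mul_le _ _).trans hKF), ?_, ?_⟩
    · simp only [coeff_sub, coeff_C_mul, z2, ← hF, hKFc, zero_sub]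
      exact neg_ne_zero.2 (mul_ne_zero (Real.exp_pos _).ne'
        (mul_ne_zero (leadingCoeff_ne_zero.2 hb) hFc))
    · simp only [coeff_sub, coeff_add, coeff_C_mul, z1, z2, ← hF, hKFc, zero_sub, zero_add, headExp]
      have h1 := exp_half_mul_exp_neg_half b
      have h2 := exp_half_mul_exp_half b
      linear_combination ((K b).leadingCoeff * F.coeff d) *
        (-Real.exp (b / 2) * h1 + Real.exp (-b / 2) * h2)

theorem transfer_eval_zero {K : ℝ → ℝ[X]} {L : List ℝ} (hK : NontrivialWeights K L) :
    (transfer K L).1.eval 0 = 0 ∧ (transfer K L).2.eval 0 = 1 := by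
  induction L with
  | nil => simp [transfer]
  | cons b L ih =>
    obtain ⟨i1, i2⟩ := ih (fun s hs => hK s (by simp [hs]))
    have hb0 := (hK b (by simp)).2
    rw [coeff_zero_eq_eval_zero] at hb0
    rw [transfer_cons]
    simp [i1, i2, hb0]

/-- The ratio `E₁ / E₂` determines the point masses: its limit at `z = ∞` gives the rightmost
point, and the polynomial part of the logarithmic derivative there gives its weight. -/
theorem eq_of_transfer_mul_eq {K K' : ℝ → ℝ[X]} {L L' : List ℝ}
    (hL : L.Pairwise (· > ·)) (hL' : L'.Pairwise (· > ·))
    (hK : NontrivialWeights K L) (hK' : NontrivialWeights K' L')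
    (h : (transfer K L).1 * (transfer K' L').2 = (transfer K L).2 * (transfer K' L').1) :
    L = L' ∧ ∀ s ∈ L, K s = K' s := by
  induction L generalizing L' with
  | nil =>
    cases L' with
    | nil => simp
    | cons b L' =>
      exfalso
      obtain ⟨-, -, h3, h4⟩ := transfer_degree hL' hK'
      simp only [transfer, zero_mul, one_mul] at h
      have h5 : (transfer K' (b :: L')).1 = 0 := h.symm
      rw [h5] at h4
      simp only [coeff_zero, headExp] at h4
      exact mul_ne_zero (neg_ne_zero.2 (Real.exp_pos b).ne') h3 h4.symm
  | cons b L ih =>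
    obtain ⟨h1, h2, h3, h4⟩ := transfer_degree hL hK
    obtain ⟨h1', h2', h3', h4'⟩ := transfer_degree hL' hK'
    have hc := congrArg (fun p => coeff p (totalDegree K (b :: L) + totalDegree K' L')) h
    simp only [coeff_mul_of_le h1 h2', coeff_mul_of_le h2 h1', h4, h4'] at hc
    have hr : headExp (b :: L) = headExp L' := by
      have : (headExp (b :: L) - headExp L') *
          ((transfer K (b :: L)).2.coeff (totalDegree K (b :: L))
          * (transfer K' L').2.coeff (totalDegree K' L')) = 0 := by
        linear_combination -hc
      rcases mul_eq_zero.1 this with h | h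
      · exact sub_eq_zero.1 h
      · exact absurd h (mul_ne_zero h3 h3')
    cases L' with
    | nil => exact absurd hr (Real.exp_pos b).ne'
    | cons b' L' =>
      have hbb : b = b' := Real.exp_injective hr
      subst hbb
      rw [List.pairwise_cons] at hL hL'
      have hKL : NontrivialWeights K L := fun s hs => hK s (by simp [hs])
      have hKL' : NontrivialWeights K' L' := fun s hs => hK' s (by simp [hs])
      obtain ⟨i1, i2, i3, i4⟩ := transfer_degree hL.2 hKL
      obtain ⟨i1', i2', i3', i4'⟩ := transfer_degree hL'.2 hKL'
      set F := valuePoly b (transfer K L) with hF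
      set F' := valuePoly b (transfer K' L') with hF'
      set D := slopePoly b (transfer K L) with hD
      set D' := slopePoly b (transfer K' L') with hD'
      have e : F * (D' - K' b * F') - (D - K b * F) * F' = 0 := by
        have := valuePoly_mul_slopePoly_sub b (transfer K (b :: L)) (transfer K' (b :: L'))
        rw [h, sub_self, valuePoly_transfer_cons, valuePoly_transfer_cons,
          slopePoly_transfer_cons, slopePoly_transfer_cons] at this
        exact this
      have e2 : F * D' - D * F' = (K' b - K b) * (F * F') := by linear_combination e
      have hFc : F.coeff (totalDegree K L) ≠ 0 :=
        coeff_valuePoly_ne_zero i4 i3 (headExp_lt hL.1)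
      have hFc' : F'.coeff (totalDegree K' L') ≠ 0 :=
        coeff_valuePoly_ne_zero i4' i3' (headExp_lt hL'.1)
      have hFd : F.natDegree ≤ totalDegree K L := natDegree_valuePoly_le i1 i2
      have hFd' : F'.natDegree ≤ totalDegree K' L' := natDegree_valuePoly_le i1' i2'
      have hDd : D.natDegree ≤ totalDegree K L := natDegree_slopePoly_le i1 i2
      have hDd' : D'.natDegree ≤ totalDegree K' L' := natDegree_slopePoly_le i1' i2'
      -- the degree of `F D' - D F'` leaves room for a constant `K' b - K b` only
      have hk : K b = K' b := by
        by_contra hne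
        have hne' : K' b - K b ≠ 0 := sub_ne_zero.2 (Ne.symm hne)
        have hp := natDegree_pos_of_coeff_zero hne' (by
          rw [coeff_sub, (hK b (by simp)).2, (hK' b (by simp)).2, sub_zero])
        have hdeg : (F * D' - D * F').natDegree ≤ totalDegree K L + totalDegree K' L' :=
          natDegree_sub_le_of_both_le (natDegree_mul_le_of_le hFd hDd')
            (natDegree_mul_le_of_le hDd hFd')
        have hc0 : (F * D' - D * F').coeff
            ((K' b - K b).natDegree + (totalDegree K L + totalDegree K' L')) = 0 :=
          coeff_eq_zero_of_natDegree_lt (by omega)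
        rw [e2, coeff_mul_of_le le_rfl (natDegree_mul_le_of_le hFd hFd'),
          coeff_mul_of_le hFd hFd'] at hc0
        exact mul_ne_zero (leadingCoeff_ne_zero.2 hne') (mul_ne_zero hFc hFc') hc0
      have e3 : (transfer K L).1 * (transfer K' L').2 = (transfer K L).2 * (transfer K' L').1 := by
        have := valuePoly_mul_slopePoly_sub b (transfer K L) (transfer K' L')
        rw [← hF, ← hF', ← hD, ← hD', e2, hk, sub_self, zero_mul] at this
        exact (sub_eq_zero.1 this.symm)
      obtain ⟨j1, j2⟩ := ih hL.2 hL'.2 hKL hKL' e3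
      refine ⟨by rw [j1], fun s hs => ?_⟩
      rcases List.mem_cons.1 hs with rfl | hs
      · exact hk
      · exact j2 s hs

/-! ### Partial fractions -/

/-- Partial fractions for a proper rational function with simple poles. -/
theorem eval_div_eval_eq_sum {F : Type*} [Field F] [IsAlgClosed F] [DecidableEq F] {A B : F[X]}
    {s : Finset F} (hs : ∀ r, B.eval r = 0 ↔ r ∈ s) (hB' : ∀ r ∈ s, B.derivative.eval r ≠ 0)
    (hdeg : A.natDegree < B.natDegree) {z : F} (hz : z ∉ s) :
    A.eval z / B.eval z = ∑ r ∈ s, A.eval r / (B.derivative.eval r * (z - r)) := by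
  have hB0 : B ≠ 0 := by rintro rfl; simp at hdeg
  have hroots : B.roots = s.val := by
    have hnd : B.roots.Nodup := by
      rw [Multiset.nodup_iff_count_le_one]
      intro r
      rw [count_roots]
      by_contra hlt
      rw [not_le, one_lt_rootMultiplicity_iff_isRoot hB0] at hlt
      exact hB' r ((hs r).1 hlt.1) hlt.2
    refine (Multiset.Nodup.ext hnd s.nodup).2 fun r => ?_
    rw [mem_roots hB0, IsRoot.def, hs]; rfl
  have hsp := IsAlgClosed.splits B
  have hcard : s.card = B.natDegree := by
    rw [hsp.natDegree_eq_card_roots, hroots]; rfl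
  have hprod : B = C B.leadingCoeff * Lagrange.nodal s id := by
    conv_lhs => rw [hsp.eq_prod_roots, hroots]
    rfl
  have hlc : B.leadingCoeff ≠ 0 := leadingCoeff_ne_zero.2 hB0
  have hA : A = Lagrange.interpolate s id fun i => A.eval i :=
    Lagrange.eq_interpolate (Set.injOn_id _) (by
      rw [hcard]
      refine lt_of_le_of_lt degree_le_natDegree ?_
      exact_mod_cast hdeg)
  have hAz : A.eval z = (Lagrange.nodal s id).eval z *
      ∑ i ∈ s, Lagrange.nodalWeight s id i * (z - id i)⁻¹ * A.eval i := by
    conv_lhs => rw [hA]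
    exact Lagrange.eval_interpolate_not_at_node _ (fun i hi h => hz (by rw [h]; exact hi))
  have hBz : B.eval z = B.leadingCoeff * (Lagrange.nodal s id).eval z := by
    conv_lhs => rw [hprod]
    simp
  have hBne : B.eval z ≠ 0 := fun h => hz ((hs z).1 h)
  have hnz : (Lagrange.nodal s id).eval z ≠ 0 := by
    intro h; exact hBne (by rw [hBz, h, mul_zero])
  rw [hAz, hBz, Finset.mul_sum, Finset.sum_div]
  refine Finset.sum_congr rfl fun r hr => ?_
  have hBr : B.derivative.eval r = B.leadingCoeff * (Lagrange.nodal s id).derivative.eval r := by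
    conv_lhs => rw [hprod]
    simp
  have hne : (Lagrange.nodal s id).derivative.eval r ≠ 0 := by
    intro h; exact hB' r hr (by rw [hBr, h, mul_zero])
  have hzr : z - r ≠ 0 := sub_ne_zero.2 fun h => hz (h ▸ hr)
  rw [Lagrange.nodalWeight_eq_eval_derivative_nodal hr, hBr]
  simp only [id]
  field_simp

/-! ### The solutions `φ_±` as polynomials in `z` -/

theorem leftDeriv_congr {f g : ℝ → ℂ} {x : ℝ} (h : f =ᶠ[𝓝 x] g) : leftDeriv f x = leftDeriv g x :=
  (h.filter_mono nhdsWithin_le_nhds).derivWithin_eq h.eq_of_nhds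

theorem wronskian_congr {f f' g g' : ℝ → ℂ} {x : ℝ} (hf : f =ᶠ[𝓝 x] f') (hg : g =ᶠ[𝓝 x] g') :
    wronskian f g x = wronskian f' g' x := by
  simp only [wronskian, leftDeriv_congr hf, leftDeriv_congr hg, hf.eq_of_nhds, hg.eq_of_nhds]

theorem eventually_eventuallyEq_atTop {f g : ℝ → ℂ} (h : ∀ᶠ x in atTop, f x = g x) :
    ∀ᶠ x in atTop, f =ᶠ[𝓝 x] g := by
  obtain ⟨b, hb⟩ := eventually_atTop.1 h
  filter_upwards [eventually_gt_atTop b] with x hx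
  filter_upwards [Ioi_mem_nhds hx] with y hy using hb y (le_of_lt hy)

theorem eventually_eventuallyEq_atBot {f g : ℝ → ℂ} (h : ∀ᶠ x in atBot, f x = g x) :
    ∀ᶠ x in atBot, f =ᶠ[𝓝 x] g := by
  obtain ⟨b, hb⟩ := eventually_atBot.1 h
  filter_upwards [eventually_lt_atBot b] with x hx
  filter_upwards [Iio_mem_nhds hx] with y hy using hb y (le_of_lt hy)

theorem cexp_half_eq (x : ℝ) : Complex.exp ((1 / 2 : ℂ) * x) = (Real.exp (x / 2) : ℂ) := by
  rw [Complex.ofReal_exp]; congr 1; push_cast; ring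

theorem cexp_neg_half_eq (x : ℝ) : Complex.exp ((-1 / 2 : ℂ) * x) = (Real.exp (-x / 2) : ℂ) := by
  rw [Complex.ofReal_exp]; congr 1; push_cast; ring

theorem eventually_coeff_atBot {g : ℝ → ℂ} (hg : ∀ᶠ x in atBot, g x = Complex.exp ((x : ℂ) / 2)) :
    ∀ᶠ x in atBot, coeffDecay g x = 0 ∧ coeffGrowth g x = 1 := by
  filter_upwards [eventually_eventuallyEq_atBot hg] with x hx
  have h1 : leftDeriv g x = 1 / 2 * Complex.exp ((1 / 2 : ℂ) * x) := by
    rw [leftDeriv_congr hx, ← leftDeriv_eq_of_hasDerivAt (hasDerivAt_cexp_mul (1 / 2) x)]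
    congr 1
    funext y; congr 1; ring
  have h2 : g x = Complex.exp ((1 / 2 : ℂ) * x) := by rw [hx.eq_of_nhds]; congr 1; ring
  constructor
  · simp only [coeffDecay, h1, h2]; ring
  · simp only [coeffGrowth, h1, h2]
    linear_combination cexp_mul_cexp_neg x

/-- The coefficients of the solution equal to `e^{x/2}` near `-∞` are the polynomials
`transfer K L`, where `L` lists the point masses to the left. -/
theorem IsJumpSolution.coeff_eq_aeval_transfer {S : Finset ℝ} {k : ℝ → ℂ} {g : ℝ → ℂ}
    (h : IsJumpSolution S k g) (hg : ∀ᶠ x in atBot, g x = Complex.exp ((x : ℂ) / 2))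
    {K : ℝ → ℝ[X]} {z : ℂ} (hk : ∀ s, k s = aeval z (K s)) {L : List ℝ}
    (hL : L.Pairwise (· > ·)) {x : ℝ} (hx : ∀ s, s ∈ L ↔ s ∈ S ∧ s < x) :
    coeffDecay g x = aeval z (transfer K L).1 ∧ coeffGrowth g x = aeval z (transfer K L).2 := by
  induction L generalizing x with
  | nil =>
    obtain ⟨y, ⟨h1, h2⟩, hy⟩ := ((eventually_coeff_atBot hg).and (eventually_le_atBot x)).exists
    obtain ⟨h3, h4⟩ := h.coeff_eq_of_no_points hy fun s hs hh => by
      simpa using (hx s).2 ⟨hs, hh.2⟩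
    simp [h3, h4, h1, h2, transfer]
  | cons b L ih =>
    rw [List.pairwise_cons] at hL
    have hb := (hx b).1 (by simp)
    obtain ⟨i1, i2⟩ := ih hL.2 (x := b) fun s => by
      constructor
      · intro hs
        exact ⟨((hx s).1 (by simp [hs])).1, hL.1 s hs⟩
      · rintro ⟨hs, hsb⟩
        rcases List.mem_cons.1 ((hx s).2 ⟨hs, hsb.trans hb.2⟩) with h | h
        · exact absurd hsb (by simp [h])
        · exact h
    have hfil : S.filter (fun s => b ≤ s ∧ s < x) = {b} := by
      ext s
      simp only [Finset.mem_filter, Finset.mem_singleton]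
      constructor
      · rintro ⟨hs, hbs, hsx⟩
        rcases List.mem_cons.1 ((hx s).2 ⟨hs, hsx⟩) with h | h
        · exact h
        · exact absurd (hL.1 s h) (not_lt.2 hbs)
      · rintro rfl
        exact ⟨hb.1, le_rfl, hb.2⟩
    have e1 := h.coeffDecay_sub hb.2.le
    have e2 := h.coeffGrowth_sub hb.2.le
    rw [hfil, Finset.sum_singleton, hk] at e1 e2
    have e3 := eq_coeff_combination g b
    rw [cexp_half_eq, cexp_neg_half_eq, i1, i2] at e3
    rw [cexp_half_eq, e3] at e1
    rw [cexp_neg_half_eq, e3] at e2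
    rw [transfer_cons]
    simp only [map_add, map_sub, map_mul, aeval_C, valuePoly, Complex.coe_algebraMap]
    rw [i1] at e1
    rw [i2] at e2
    constructor
    · linear_combination e1
    · linear_combination e2

/-- The weight `z ω(s) + z² v(s)` as a polynomial in `z`. -/
noncomputable def weightPoly (P : DiscretePair) (s : ℝ) : ℝ[X] :=
  C (P.omega s) * X + C (P.v s) * X ^ 2

theorem aeval_weightPoly (P : DiscretePair) (z : ℂ) (s : ℝ) :
    aeval z (weightPoly P s) = z * P.omega s + z ^ 2 * P.v s := by
  simp [weightPoly]; ring

theorem weightPoly_coeff (P : DiscretePair) (s : ℝ) :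
    (weightPoly P s).coeff 0 = 0 ∧ (weightPoly P s).coeff 1 = P.omega s ∧
      (weightPoly P s).coeff 2 = P.v s := by
  simp [weightPoly, coeff_X, coeff_X_pow]

theorem weightPoly_eq_zero_iff (P : DiscretePair) (s : ℝ) : weightPoly P s = 0 ↔ s ∉ P.points := by
  obtain ⟨-, h1, h2⟩ := weightPoly_coeff P s
  simp only [DiscretePair.points, Finset.mem_union, Finsupp.mem_support_iff, not_or, not_not]
  constructor
  · intro h
    rw [h] at h1 h2
    exact ⟨by simpa using h1.symm, by simpa using h2.symm⟩
  · rintro ⟨h3, h4⟩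
    simp [weightPoly, h3, h4]

/-- The decreasing list of the elements of a finite set. -/
noncomputable def descending (S : Finset ℝ) : List ℝ := S.sort (· ≥ ·)

theorem mem_descending {S : Finset ℝ} {s : ℝ} : s ∈ descending S ↔ s ∈ S := Finset.mem_sort _

theorem descending_pairwise (S : Finset ℝ) : (descending S).Pairwise (· > ·) := by
  have h1 := Finset.pairwise_sort S (· ≥ ·)
  have h2 : (S.sort (· ≥ ·)).Pairwise (· ≠ ·) := Finset.sort_nodup S (· ≥ ·)
  exact (h1.and h2).imp fun {a b} h => lt_of_le_of_ne h.1 (Ne.symm h.2)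

/-- The point masses to the left of `a`. -/
noncomputable def leftList (P : DiscretePair) (a : ℝ) : List ℝ :=
  descending (P.points.filter (· < a))

/-- The point masses at and to the right of `a`, reflected at the origin. -/
noncomputable def rightList (P : DiscretePair) (a : ℝ) : List ℝ :=
  descending ((P.points.filter (a ≤ ·)).image fun x => -x)

theorem mem_leftList {P : DiscretePair} {a s : ℝ} : s ∈ leftList P a ↔ s ∈ P.points ∧ s < a := by
  rw [leftList, mem_descending, Finset.mem_filter]

theorem mem_rightList {P : DiscretePair} {a s : ℝ} :
    s ∈ rightList P a ↔ -s ∈ P.points ∧ s ≤ -a := by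
  rw [rightList, mem_descending, Finset.mem_image]
  constructor
  · rintro ⟨t, ht, rfl⟩
    rw [Finset.mem_filter] at ht
    simpa using ht
  · rintro ⟨h1, h2⟩
    exact ⟨-s, by rw [Finset.mem_filter]; exact ⟨h1, by linarith⟩, by simp⟩

theorem leftList_pairwise (P : DiscretePair) (a : ℝ) : (leftList P a).Pairwise (· > ·) :=
  descending_pairwise _

theorem rightList_pairwise (P : DiscretePair) (a : ℝ) : (rightList P a).Pairwise (· > ·) :=
  descending_pairwise _

/-- The coefficients of `φ₋(z, ·)` to the left of `a`. -/
noncomputable def leftCoeffs (P : DiscretePair) (a : ℝ) : ℝ[X] × ℝ[X] :=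
  transfer (weightPoly P) (leftList P a)

/-- The coefficients of the reflection `x ↦ φ₊(z, -x)` to the right of `-a`. -/
noncomputable def rightCoeffs (P : DiscretePair) (a : ℝ) : ℝ[X] × ℝ[X] :=
  transfer (fun s => weightPoly P (-s)) (rightList P a)

theorem nontrivialWeights_left (P : DiscretePair) (a : ℝ) :
    NontrivialWeights (weightPoly P) (leftList P a) := fun s hs =>
  ⟨fun h => (weightPoly_eq_zero_iff P s).1 h (mem_leftList.1 hs).1, (weightPoly_coeff P s).1⟩

theorem nontrivialWeights_right (P : DiscretePair) (a : ℝ) :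
    NontrivialWeights (fun s => weightPoly P (-s)) (rightList P a) := fun s hs =>
  ⟨fun h => (weightPoly_eq_zero_iff P (-s)).1 h (mem_rightList.1 hs).1, (weightPoly_coeff P (-s)).1⟩

/-- The polynomial `z ↦ φ₋(z, a)`. -/
noncomputable def minusPoly (P : DiscretePair) (a : ℝ) : ℝ[X] := valuePoly a (leftCoeffs P a)

/-- The polynomial `z ↦ φ₋'(z, a)`. -/
noncomputable def minusSlopePoly (P : DiscretePair) (a : ℝ) : ℝ[X] := slopePoly a (leftCoeffs P a)

/-- The polynomial `z ↦ φ₊(z, a)`. -/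
noncomputable def plusPoly (P : DiscretePair) (a : ℝ) : ℝ[X] := valuePoly (-a) (rightCoeffs P a)

/-- The polynomial `z ↦ -φ₊'(z, a)`. -/
noncomputable def plusSlopePoly (P : DiscretePair) (a : ℝ) : ℝ[X] :=
  slopePoly (-a) (rightCoeffs P a)

theorem aeval_valuePoly (z : ℂ) (x : ℝ) (E : ℝ[X] × ℝ[X]) :
    aeval z (valuePoly x E) = aeval z E.1 * Complex.exp ((-1 / 2 : ℂ) * x)
      + aeval z E.2 * Complex.exp ((1 / 2 : ℂ) * x) := by
  rw [cexp_half_eq, cexp_neg_half_eq]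
  simp only [valuePoly, map_add, map_mul, aeval_C, Complex.coe_algebraMap]
  ring

theorem aeval_slopePoly (z : ℂ) (x : ℝ) (E : ℝ[X] × ℝ[X]) :
    aeval z (slopePoly x E) = (aeval z E.2 * Complex.exp ((1 / 2 : ℂ) * x)
      - aeval z E.1 * Complex.exp ((-1 / 2 : ℂ) * x)) / 2 := by
  rw [cexp_half_eq, cexp_neg_half_eq]
  simp only [slopePoly, map_sub, map_mul, aeval_C, Complex.coe_algebraMap]
  push_cast
  ring

theorem coeff_phiMinus (P : DiscretePair) (z : ℂ) (a : ℝ) :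
    coeffDecay (phiMinus P z) a = aeval z (leftCoeffs P a).1 ∧
      coeffGrowth (phiMinus P z) a = aeval z (leftCoeffs P a).2 :=
  (phiMinus_spec P z).1.coeff_eq_aeval_transfer (phiMinus_spec P z).2
    (fun s => (aeval_weightPoly P z s).symm) (leftList_pairwise P a) fun _ => mem_leftList

theorem phiMinus_eq_aeval (P : DiscretePair) (z : ℂ) (a : ℝ) :
    phiMinus P z a = aeval z (minusPoly P a) := by
  rw [minusPoly, aeval_valuePoly, ← (coeff_phiMinus P z a).1, ← (coeff_phiMinus P z a).2]
  exact eq_coeff_combination _ _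

theorem leftDeriv_phiMinus (P : DiscretePair) (z : ℂ) (a : ℝ) :
    leftDeriv (phiMinus P z) a = aeval z (minusSlopePoly P a) := by
  rw [minusSlopePoly, aeval_slopePoly, ← (coeff_phiMinus P z a).1, ← (coeff_phiMinus P z a).2]
  exact leftDeriv_eq_coeff_combination _ _

/-- The representation of `φ₊` on an interval to the left of `a`, up to `a`. -/
theorem phiPlus_eventuallyEq (P : DiscretePair) (z : ℂ) (a : ℝ) :
    phiPlus P z =ᶠ[𝓝[≤] a] fun x : ℝ =>
      aeval z (rightCoeffs P a).1 * Complex.exp ((1 / 2 : ℂ) * x)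
        + aeval z (rightCoeffs P a).2 * Complex.exp ((-1 / 2 : ℂ) * x) := by
  obtain ⟨hs, he⟩ := phiPlus_spec P z
  set g : ℝ → ℂ := fun x => phiPlus P z (-x) with hg
  have hgs := hs.neg_comp
  have hge : ∀ᶠ x in atBot, g x = Complex.exp ((x : ℂ) / 2) := by
    filter_upwards [tendsto_neg_atBot_atTop.eventually he] with x hx
    rw [hg]
    simp only [hx]
    simp
  have hlt : ∀ᶠ x in 𝓝[<] a, phiPlus P z x =
      aeval z (rightCoeffs P a).1 * Complex.exp ((1 / 2 : ℂ) * x)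
        + aeval z (rightCoeffs P a).2 * Complex.exp ((-1 / 2 : ℂ) * x) := by
    have := IsJumpSolution.eventually_not_mem_left P.points a
    rw [Filter.Eventually, mem_nhdsLT_iff_exists_Ioo_subset] at this
    obtain ⟨d, hd, hsub⟩ := this
    filter_upwards [Ioo_mem_nhdsLT hd] with x hx
    obtain ⟨h1, h2⟩ := hgs.coeff_eq_aeval_transfer hge (K := fun s => weightPoly P (-s)) (z := z)
      (fun s => (aeval_weightPoly P z (-s)).symm) (L := rightList P a) (rightList_pairwise P a)
      (x := -x) (fun s => by
        rw [mem_rightList, Finset.mem_image]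
        constructor
        · rintro ⟨h1, h2⟩
          exact ⟨⟨-s, h1, by simp⟩, by linarith [hx.2]⟩
        · rintro ⟨⟨t, ht, rfl⟩, h2⟩
          refine ⟨by simpa using ht, ?_⟩
          by_contra h3
          exact hsub ⟨hx.1.trans (by linarith), by linarith⟩ ht)
    have h3 := eq_coeff_combination g (-x)
    change coeffDecay g (-x) = _ at h1
    change coeffGrowth g (-x) = _ at h2
    rw [h1, h2] at h3
    simp only [hg, neg_neg] at h3
    rw [h3, rightCoeffs]
    push_cast
    rw [show (-1 / 2 : ℂ) * -x = 1 / 2 * x by ring, show (1 / 2 : ℂ) * -x = -1 / 2 * x by ring]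
  have ha : phiPlus P z a = aeval z (rightCoeffs P a).1 * Complex.exp ((1 / 2 : ℂ) * a)
        + aeval z (rightCoeffs P a).2 * Complex.exp ((-1 / 2 : ℂ) * a) := by
    have hc : Continuous (fun x : ℝ => aeval z (rightCoeffs P a).1 * Complex.exp ((1 / 2 : ℂ) * x)
        + aeval z (rightCoeffs P a).2 * Complex.exp ((-1 / 2 : ℂ) * x)) := by fun_prop
    have h1 : Tendsto (phiPlus P z) (𝓝[<] a) (𝓝 (phiPlus P z a)) :=
      hs.continuous.continuousAt.mono_left nhdsWithin_le_nhds
    exact tendsto_nhds_unique (h1.congr' hlt) (hc.continuousAt.mono_left nhdsWithin_le_nhds)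
  rw [EventuallyEq, eventually_nhdsWithin_iff]
  rw [eventually_nhdsWithin_iff] at hlt
  filter_upwards [hlt] with x hx hxa
  rcases (Set.mem_Iic.1 hxa).lt_or_eq with h | h
  · exact hx h
  · rw [h]; exact ha

theorem phiPlus_eq_aeval (P : DiscretePair) (z : ℂ) (a : ℝ) :
    phiPlus P z a = aeval z (plusPoly P a) := by
  rw [(phiPlus_eventuallyEq P z a).self_of_nhdsWithin Set.self_mem_Iic, plusPoly, aeval_valuePoly]
  push_cast
  rw [show (-1 / 2 : ℂ) * -a = 1 / 2 * a by ring, show (1 / 2 : ℂ) * -a = -1 / 2 * a by ring]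

theorem leftDeriv_phiPlus (P : DiscretePair) (z : ℂ) (a : ℝ) :
    leftDeriv (phiPlus P z) a = -aeval z (plusSlopePoly P a) := by
  have h := phiPlus_eventuallyEq P z a
  rw [leftDeriv, h.derivWithin_eq (h.self_of_nhdsWithin Set.self_mem_Iic)]
  have hd := ((hasDerivAt_cexp_mul (1 / 2) a).const_mul (aeval z (rightCoeffs P a).1)).add
    ((hasDerivAt_cexp_mul (-1 / 2) a).const_mul (aeval z (rightCoeffs P a).2))
  refine (leftDeriv_eq_of_hasDerivAt hd).trans ?_
  rw [plusSlopePoly, aeval_slopePoly]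
  push_cast
  rw [show (-1 / 2 : ℂ) * -a = 1 / 2 * a by ring, show (1 / 2 : ℂ) * -a = -1 / 2 * a by ring]
  ring

/-- The Wronskian of `φ₊` and `φ₋`, as a polynomial in `z`. -/
noncomputable def wronskianPoly (P : DiscretePair) (a : ℝ) : ℝ[X] :=
  (rightCoeffs P a).2 * (leftCoeffs P a).2 - (rightCoeffs P a).1 * (leftCoeffs P a).1

theorem wronskianPoly_eq (P : DiscretePair) (a : ℝ) :
    wronskianPoly P a =
      plusPoly P a * minusSlopePoly P a + plusSlopePoly P a * minusPoly P a := by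
  have h := C_exp_half_mul a
  have h2 : (C (1 / 2) * 2 : ℝ[X]) = 1 := by
    rw [show (2 : ℝ[X]) = C 2 from rfl, ← C_mul]; norm_num
  simp only [plusPoly, plusSlopePoly, minusPoly, minusSlopePoly, wronskianPoly, valuePoly,
    slopePoly, neg_neg]
  linear_combination (-((rightCoeffs P a).2 * (leftCoeffs P a).2 -
    (rightCoeffs P a).1 * (leftCoeffs P a).1)) * ((C (1 / 2) * 2) * h + h2)

theorem wronskian_phi (P : DiscretePair) (z : ℂ) (a x : ℝ) :
    wronskian (phiPlus P z) (phiMinus P z) x = aeval z (wronskianPoly P a) := by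
  rw [(phiPlus_spec P z).1.wronskian_eq (phiMinus_spec P z).1 x a, wronskian, leftDeriv_phiPlus,
    leftDeriv_phiMinus, phiPlus_eq_aeval, phiMinus_eq_aeval, wronskianPoly_eq]
  simp only [map_add, map_mul]
  ring

theorem natDegree_minusPoly (P : DiscretePair) (a : ℝ) :
    (minusPoly P a).natDegree = totalDegree (weightPoly P) (leftList P a) := by
  obtain ⟨h1, h2, h3, h4⟩ := transfer_degree (leftList_pairwise P a) (nontrivialWeights_left P a)
  exact natDegree_eq_of_le_of_coeff_ne_zero (natDegree_valuePoly_le h1 h2)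
    (coeff_valuePoly_ne_zero h4 h3 (headExp_lt fun s hs => (mem_leftList.1 hs).2))

theorem natDegree_minusSlopePoly_le (P : DiscretePair) (a : ℝ) :
    (minusSlopePoly P a).natDegree ≤ (minusPoly P a).natDegree := by
  obtain ⟨h1, h2, -, -⟩ := transfer_degree (leftList_pairwise P a) (nontrivialWeights_left P a)
  rw [natDegree_minusPoly]
  exact natDegree_slopePoly_le h1 h2

/-- The degree of `W` is the sum of the degrees of all weights: the leading terms of the two
products do not cancel. -/
theorem natDegree_wronskianPoly (P : DiscretePair) (a : ℝ) :
    (wronskianPoly P a).natDegree = totalDegree (fun s => weightPoly P (-s)) (rightList P a)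
      + totalDegree (weightPoly P) (leftList P a) := by
  obtain ⟨h1, h2, h3, h4⟩ := transfer_degree (leftList_pairwise P a) (nontrivialWeights_left P a)
  obtain ⟨i1, i2, i3, i4⟩ := transfer_degree (rightList_pairwise P a) (nontrivialWeights_right P a)
  refine natDegree_eq_of_le_of_coeff_ne_zero
    (natDegree_sub_le_of_both_le (natDegree_mul_le_of_le i2 h2) (natDegree_mul_le_of_le i1 h1)) ?_
  rw [wronskianPoly, rightCoeffs, leftCoeffs, coeff_sub, coeff_mul_of_le i2 h2,
    coeff_mul_of_le i1 h1, h4, i4]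
  -- the leading coefficient is a nonzero multiple of `1 - e^{b - b'}` with masses `b < a ≤ b'`
  have hr : headExp (rightList P a) * headExp (leftList P a) < 1 := by
    have e1 : headExp (rightList P a) ≤ Real.exp (-a) :=
      headExp_le fun s hs => (mem_rightList.1 hs).2
    have e2 : headExp (leftList P a) < Real.exp a := headExp_lt fun s hs => (mem_leftList.1 hs).2
    calc _ ≤ Real.exp (-a) * headExp (leftList P a) :=
          mul_le_mul_of_nonneg_right e1 (headExp_nonneg _)
      _ < Real.exp (-a) * Real.exp a := mul_lt_mul_of_pos_left e2 (Real.exp_pos _)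
      _ = 1 := by rw [← Real.exp_add]; simp
  have : ∀ p q r s : ℝ, p * q - -r * p * (-s * q) = p * q * (1 - r * s) := by intros; ring
  rw [this]
  exact mul_ne_zero (mul_ne_zero i3 h3) (sub_pos.2 hr).ne'

theorem natDegree_plusPoly_mul_minusPoly_le (P : DiscretePair) (a : ℝ) :
    (plusPoly P a * minusPoly P a).natDegree ≤ (wronskianPoly P a).natDegree := by
  obtain ⟨i1, i2, i3, i4⟩ := transfer_degree (rightList_pairwise P a) (nontrivialWeights_right P a)
  rw [natDegree_wronskianPoly]
  exact natDegree_mul_le_of_le (natDegree_valuePoly_le i1 i2) (natDegree_minusPoly P a).le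

theorem eval_zero_polys (P : DiscretePair) (a : ℝ) :
    (minusPoly P a).eval 0 = Real.exp (a / 2) ∧
    (minusSlopePoly P a).eval 0 = Real.exp (a / 2) / 2 ∧
    (plusPoly P a).eval 0 = Real.exp (-a / 2) ∧ (wronskianPoly P a).eval 0 = 1 := by
  obtain ⟨h1, h2⟩ := transfer_eval_zero (nontrivialWeights_left P a)
  obtain ⟨i1, i2⟩ := transfer_eval_zero (nontrivialWeights_right P a)
  simp only [minusPoly, minusSlopePoly, plusPoly, wronskianPoly, valuePoly, slopePoly, leftCoeffs,
    rightCoeffs, eval_add, eval_sub, eval_mul, eval_C, h1, h2, i1, i2]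
  refine ⟨by ring, by ring, by ring, by ring⟩

/-! ### The spectrum and the norming constants -/

theorem phiPlus_ne_zero (P : DiscretePair) (z : ℂ) : phiPlus P z ≠ 0 := by
  intro h
  obtain ⟨x, hx⟩ := (phiPlus_spec P z).2.exists
  rw [h] at hx
  exact Complex.exp_ne_zero _ hx.symm

theorem phiMinus_ne_zero (P : DiscretePair) (z : ℂ) : phiMinus P z ≠ 0 := by
  intro h
  obtain ⟨x, hx⟩ := (phiMinus_spec P z).2.exists
  rw [h] at hx
  exact Complex.exp_ne_zero _ hx.symm

theorem exists_phiMinus_eq_of_mem_spec {P : DiscretePair} {z : ℂ} (hz : z ∈ spec P) :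
    ∃ c : ℂ, c ≠ 0 ∧ ∀ x, phiMinus P z x = c * phiPlus P z x := by
  obtain ⟨f, hf, hne, C, hC⟩ := hz
  obtain ⟨hp, hpe⟩ := phiPlus_spec P z
  obtain ⟨hm, hme⟩ := phiMinus_spec P z
  obtain ⟨A, hA⟩ := hf.exists_eq_mul_of_bounded hp hpe hC
  obtain ⟨B, hB⟩ := hf.neg_comp.exists_eq_mul_of_bounded hm.neg_comp (by
    filter_upwards [tendsto_neg_atTop_atBot.eventually hme] with x hx
    rw [hx]; simp) (fun x => hC (-x))
  have hB' : ∀ x, f x = B * phiMinus P z x := fun x => by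
    simpa using congrFun hB (-x)
  have hA0 : A ≠ 0 := by rintro rfl; exact hne (by rw [hA]; funext x; simp)
  have hB0 : B ≠ 0 := by rintro rfl; exact hne (by funext x; simp [hB'])
  refine ⟨A / B, div_ne_zero hA0 hB0, fun x => ?_⟩
  have h1 := hB' x
  rw [hA] at h1
  simp only at h1
  field_simp
  linear_combination -h1

theorem leftDeriv_const_mul (f : ℝ → ℂ) (c : ℂ) (x : ℝ) :
    leftDeriv (fun y => c * f y) x = c * leftDeriv f x := by
  simp only [leftDeriv]
  exact derivWithin_const_mul_field c

/-- The eigenvalues are the zeros of the Wronskian. -/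
theorem mem_spec_iff (P : DiscretePair) (a : ℝ) (z : ℂ) :
    z ∈ spec P ↔ aeval z (wronskianPoly P a) = 0 := by
  constructor
  · intro hz
    obtain ⟨c, -, hc⟩ := exists_phiMinus_eq_of_mem_spec hz
    have h2 : phiMinus P z = fun x => c * phiPlus P z x := funext hc
    rw [← wronskian_phi P z a a, h2, wronskian, leftDeriv_const_mul]
    ring
  · intro h0
    obtain ⟨hp, hpe⟩ := phiPlus_spec P z
    obtain ⟨hm, hme⟩ := phiMinus_spec P z
    obtain ⟨A, B, hAB⟩ := hm.eventually_atTop_coeff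
    have hpe' : ∀ᶠ x : ℝ in atTop, phiPlus P z x = Complex.exp ((-1 / 2 : ℂ) * x) := by
      filter_upwards [hpe] with x hx
      rw [hx]; congr 1; ring
    -- far to the right the Wronskian is the coefficient of `e^{x/2}` in `φ₋`
    have hB : B = 0 := by
      obtain ⟨x, h1, h2⟩ := (hAB.and (eventually_eventuallyEq_atTop hpe')).exists
      rw [← h1.2, coeffGrowth_eq_wronskian]
      have h3 := wronskian_phi P z a x
      rw [h0, wronskian_congr h2 (EventuallyEq.refl _ _)] at h3
      simp only [wronskian] at h3 ⊢
      linear_combination h3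
    have heq : phiMinus P z = fun x => A * phiPlus P z x := by
      refine hm.eq_of_eventually_atTop (hp.const_mul A) ?_
      filter_upwards [hAB, hpe'] with x h1 h2
      rw [h2, ← h1.1, eq_coeff_combination (phiMinus P z) x, h1.2, hB]
      ring
    refine ⟨phiMinus P z, hm, phiMinus_ne_zero P z, ?_⟩
    obtain ⟨b, hb⟩ := eventually_atTop.1 hpe
    obtain ⟨d, hd⟩ := eventually_atBot.1 hme
    obtain ⟨M, hM⟩ := isCompact_Icc.exists_bound_of_continuousOn (s := Set.Icc d b)
      hm.continuous.continuousOn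
    refine ⟨max M (max (‖A‖ * Real.exp (-b / 2)) (Real.exp (d / 2))), fun x => ?_⟩
    rcases le_total x d with h | h
    · refine le_max_of_le_right (le_max_of_le_right ?_)
      rw [hd x h, show (x : ℂ) / 2 = ((x / 2 : ℝ) : ℂ) by push_cast; rfl, Complex.norm_exp_ofReal]
      exact Real.exp_le_exp.2 (by linarith)
    rcases le_total b x with h' | h'
    · refine le_max_of_le_right (le_max_of_le_left ?_)
      rw [heq]
      simp only [norm_mul]
      rw [hb x h', show -(x : ℂ) / 2 = ((-x / 2 : ℝ) : ℂ) by push_cast; rfl,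
        Complex.norm_exp_ofReal]
      exact mul_le_mul_of_nonneg_left (Real.exp_le_exp.2 (by linarith)) (norm_nonneg _)
    · exact le_max_of_le_left (hM x ⟨h, h'⟩)

/-- Green's identity for `φ₊(w, ·)` and `φ₋(z, ·)` on the whole line. -/
theorem aeval_wronskianPoly_sub (P : DiscretePair) (a : ℝ) (z w : ℂ) :
    aeval z (wronskianPoly P a) - aeval w (wronskianPoly P a) =
      ∑ s ∈ P.points, ((w * P.omega s + w ^ 2 * P.v s) - (z * P.omega s + z ^ 2 * P.v s))
        * phiPlus P w s * phiMinus P z s := by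
  obtain ⟨hp, hpe⟩ := phiPlus_spec P w
  obtain ⟨hm, hme⟩ := phiMinus_spec P z
  obtain ⟨hp', hpe'⟩ := phiPlus_spec P z
  obtain ⟨hm', hme'⟩ := phiMinus_spec P w
  have e1 : ∀ᶠ x in atTop, phiPlus P w x = phiPlus P z x := by
    filter_upwards [hpe, hpe'] with x h1 h2; rw [h1, h2]
  have e2 : ∀ᶠ x in atBot, phiMinus P z x = phiMinus P w x := by
    filter_upwards [hme, hme'] with x h1 h2; rw [h1, h2]
  obtain ⟨u, hu⟩ := P.points.bddAbove
  obtain ⟨l, hl⟩ := P.points.bddBelow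
  obtain ⟨y, hy1, hy2, hy3⟩ := ((eventually_eventuallyEq_atTop e1).and
    ((eventually_gt_atTop u).and (eventually_ge_atTop l))).exists
  obtain ⟨x, hx1, hx2, hx3⟩ := ((eventually_eventuallyEq_atBot e2).and
    ((eventually_le_atBot l).and (eventually_le_atBot y))).exists
  have h := hp.wronskian_sub hm hx3
  rw [wronskian_congr hy1 (EventuallyEq.refl _ _), wronskian_phi P z a,
    wronskian_congr (EventuallyEq.refl _ _) hx1, wronskian_phi P w a,
    Finset.filter_true_of_mem fun s hs => ⟨hx2.trans (hl hs), (hu hs).trans_lt hy2⟩] at h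
  exact h

theorem aeval_ofReal (p : ℝ[X]) (x : ℝ) : aeval (x : ℂ) p = ((p.eval x : ℝ) : ℂ) := by
  have := aeval_algebraMap_apply ℂ x p
  simpa using this

/-- The derivative of the Wronskian at a real point. -/
theorem eval_derivative_wronskianPoly (P : DiscretePair) (a lam : ℝ) :
    (wronskianPoly P a).derivative.eval lam = -∑ s ∈ P.points, (P.omega s + 2 * lam * P.v s)
      * (plusPoly P s).eval lam * (minusPoly P s).eval lam := by
  have h : wronskianPoly P a - C ((wronskianPoly P a).eval lam) = -(X - C lam) *
      ∑ s ∈ P.points, (C (P.omega s) + (X + C lam) * C (P.v s)) * C ((plusPoly P s).eval lam)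
        * minusPoly P s := by
    refine Polynomial.funext fun t => ?_
    have h1 := aeval_wronskianPoly_sub P a t lam
    simp only [phiPlus_eq_aeval, phiMinus_eq_aeval, aeval_ofReal] at h1
    have h2 : (wronskianPoly P a).eval t - (wronskianPoly P a).eval lam =
      ∑ s ∈ P.points, ((lam * P.omega s + lam ^ 2 * P.v s) - (t * P.omega s + t ^ 2 * P.v s))
        * (plusPoly P s).eval lam * (minusPoly P s).eval t := by
      exact_mod_cast h1
    simp only [eval_sub, eval_C, h2, eval_mul, eval_neg, eval_X, eval_finsetSum, eval_add,
      Finset.mul_sum]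
    exact Finset.sum_congr rfl fun s _ => by ring
  have h2 := congrArg (fun p => (derivative p).eval lam) h
  simp only [derivative_sub, derivative_C, sub_zero, derivative_mul, derivative_neg, derivative_X,
    eval_add, eval_mul, eval_neg, eval_sub, eval_X, eval_C, sub_self, neg_zero, zero_mul, add_zero,
    eval_one, eval_finsetSum] at h2
  rw [h2, neg_one_mul]
  congr 1
  exact Finset.sum_congr rfl fun s _ => by ring

theorem gammaSq_eq (P : DiscretePair) (lam : ℝ) :
    gammaSq P lam =
      ∑ s ∈ P.points, (P.omega s + 2 * lam * P.v s) * (plusPoly P s).eval lam ^ 2 := by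
  simp only [gammaSq, phiPlus_eq_aeval, aeval_ofReal, Complex.norm_real, Real.norm_eq_abs, sq_abs,
    Finset.mul_sum, ← Finset.sum_add_distrib]
  exact Finset.sum_congr rfl fun s _ => by ring

/-- At an eigenvalue, `φ₋ = c φ₊` with a real `c ≠ 0`, and `W' = -c γ²`. -/
theorem exists_proportionality {P : DiscretePair} (a : ℝ) {lam : ℝ} (h : (lam : ℂ) ∈ spec P) :
    ∃ c : ℝ, c ≠ 0 ∧ (∀ x, (minusPoly P x).eval lam = c * (plusPoly P x).eval lam) ∧
      (wronskianPoly P a).derivative.eval lam = -c * gammaSq P lam := by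
  obtain ⟨c, hc0, hc⟩ := exists_phiMinus_eq_of_mem_spec h
  simp only [phiPlus_eq_aeval, phiMinus_eq_aeval, aeval_ofReal] at hc
  obtain ⟨x, hx⟩ : ∃ x, (plusPoly P x).eval lam ≠ 0 := by
    by_contra hh
    push Not at hh
    refine phiPlus_ne_zero P lam (funext fun x => ?_)
    rw [phiPlus_eq_aeval, aeval_ofReal, hh]; simp
  have hcr : c = (((minusPoly P x).eval lam / (plusPoly P x).eval lam : ℝ) : ℂ) := by
    have hx' : ((eval lam (plusPoly P x) : ℝ) : ℂ) ≠ 0 := by exact_mod_cast hx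
    push_cast
    rw [hc x]; field_simp
  set r := (minusPoly P x).eval lam / (plusPoly P x).eval lam
  rw [hcr] at hc hc0
  have hc' : ∀ x, (minusPoly P x).eval lam = r * (plusPoly P x).eval lam := fun x => by
    exact_mod_cast hc x
  refine ⟨r, by exact_mod_cast hc0, hc', ?_⟩
  rw [eval_derivative_wronskianPoly, gammaSq_eq, neg_mul, Finset.mul_sum]
  congr 1
  exact Finset.sum_congr rfl fun s _ => by rw [hc' s]; ring

/-! ### Weyl–Titchmarsh functions determine the pair -/

/-- The Weyl–Titchmarsh functions off the real axis determine the pair. -/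
theorem eq_of_weyl_eq {P P' : DiscretePair} {a : ℝ}
    (hm : ∀ z : ℂ, z.im ≠ 0 → weylMinus P a z = weylMinus P' a z)
    (hp : ∀ z : ℂ, z.im ≠ 0 → weylPlus P a z = weylPlus P' a z) : P = P' := by
  -- equality off the real axis, where `p` and `p'` have only finitely many zeros, is an identity
  -- of polynomials
  have key : ∀ p q p' q' : ℝ[X], p ≠ 0 → p' ≠ 0 →
      (∀ z : ℂ, z.im ≠ 0 → aeval z q / (z * aeval z p) = aeval z q' / (z * aeval z p')) →
      p * q' - q * p' = 0 := by
    intro p q p' q' h0 h0' h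
    have hinj : Function.Injective (Polynomial.map (algebraMap ℝ ℂ)) :=
      Polynomial.map_injective _ (algebraMap ℝ ℂ).injective
    have hfin : ∀ r : ℝ[X], r ≠ 0 → {z : ℂ | aeval z r = 0}.Finite := fun r hr => by
      have hr' : r.map (algebraMap ℝ ℂ) ≠ 0 := fun h => hr (hinj (by simpa using h))
      refine (Multiset.finite_toSet (r.map (algebraMap ℝ ℂ)).roots).subset fun z hz => ?_
      change z ∈ (r.map (algebraMap ℝ ℂ)).roots
      rw [mem_roots hr', IsRoot.def, eval_map_algebraMap]
      exact hz
    have hinf : ({z : ℂ | z.im ≠ 0} \ ({z | aeval z p = 0} ∪ {z | aeval z p' = 0})).Infinite := by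
      refine Set.Infinite.sdiff ?_ ((hfin p h0).union (hfin p' h0'))
      refine Set.infinite_of_injective_forall_mem (f := fun n : ℕ => (n : ℂ) + Complex.I) ?_ ?_
      · intro m n hmn
        have : (m : ℂ) = n := add_right_cancel hmn
        exact_mod_cast this
      · intro n; simp
    by_contra hne
    refine hinf ((hfin _ hne).subset ?_)
    rintro z ⟨hz, hz2⟩
    simp only [Set.mem_union, Set.mem_ofPred_eq, not_or] at hz2
    have hz0 : z ≠ 0 := by rintro rfl; exact hz rfl
    have := h z hz
    rw [div_eq_div_iff (mul_ne_zero hz0 hz2.1) (mul_ne_zero hz0 hz2.2)] at this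
    have h3 : z * (aeval z q * aeval z p' - aeval z q' * aeval z p) = 0 := by
      linear_combination this
    rcases mul_eq_zero.1 h3 with h | h
    · exact absurd h hz0
    · change aeval z _ = 0
      simp only [map_sub, map_mul]
      linear_combination -h
  have hpm : ∀ P : DiscretePair, minusPoly P a ≠ 0 := fun P h => by
    have := (eval_zero_polys P a).1
    rw [h, eval_zero] at this
    exact (Real.exp_pos _).ne this
  have hpp : ∀ P : DiscretePair, plusPoly P a ≠ 0 := fun P h => by
    have := (eval_zero_polys P a).2.2.1
    rw [h, eval_zero] at this
    exact (Real.exp_pos _).ne this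
  have e1 := key (minusPoly P a) (minusSlopePoly P a) (minusPoly P' a) (minusSlopePoly P' a)
    (hpm P) (hpm P') fun z hz => by
      have := hm z hz
      simp only [weylMinus, leftDeriv_phiMinus, phiMinus_eq_aeval, neg_inj] at this
      exact this
  have e2 := key (plusPoly P a) (plusSlopePoly P a) (plusPoly P' a) (plusSlopePoly P' a)
    (hpp P) (hpp P') fun z hz => by
      have := hp z hz
      simp only [weylPlus, leftDeriv_phiPlus, phiPlus_eq_aeval, neg_div, neg_inj] at this
      exact this
  simp only [minusPoly, minusSlopePoly, plusPoly, plusSlopePoly, valuePoly_mul_slopePoly_sub]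
    at e1 e2
  obtain ⟨l1, l2⟩ := eq_of_transfer_mul_eq (leftList_pairwise P a) (leftList_pairwise P' a)
    (nontrivialWeights_left P a) (nontrivialWeights_left P' a) (sub_eq_zero.1 e1)
  obtain ⟨r1, r2⟩ := eq_of_transfer_mul_eq (rightList_pairwise P a) (rightList_pairwise P' a)
    (nontrivialWeights_right P a) (nontrivialWeights_right P' a) (sub_eq_zero.1 e2)
  have hw : ∀ s, weightPoly P s = weightPoly P' s := by
    intro s
    rcases lt_or_ge s a with h | h
    · by_cases hs : s ∈ leftList P a
      · exact l2 s hs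
      · have h1 : s ∉ P.points := fun h' => hs (mem_leftList.2 ⟨h', h⟩)
        have h2 : s ∉ P'.points := fun h' => hs (by
          rw [l1]; exact mem_leftList.2 ⟨h', h⟩)
        rw [(weightPoly_eq_zero_iff P s).2 h1, (weightPoly_eq_zero_iff P' s).2 h2]
    · by_cases hs : -s ∈ rightList P a
      · simpa using r2 (-s) hs
      · have h1 : s ∉ P.points := fun h' => hs (mem_rightList.2 ⟨by simpa using h', by linarith⟩)
        have h2 : s ∉ P'.points := fun h' => hs (by
          rw [r1]
          exact mem_rightList.2 ⟨by simpa using h', by linarith⟩)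
        rw [(weightPoly_eq_zero_iff P s).2 h1, (weightPoly_eq_zero_iff P' s).2 h2]
  ext s
  · rw [← (weightPoly_coeff P s).2.1, hw s, (weightPoly_coeff P' s).2.1]
  · rw [← (weightPoly_coeff P s).2.2, hw s, (weightPoly_coeff P' s).2.2]

/-! ### Reconstruction of the Weyl–Titchmarsh functions from the data -/

/-- Interior spectral data of `P` at `a` with `α = β = 0` and no vanishing `φ_i(a)`. -/
structure IsBalancedData (P : DiscretePair) (a : ℝ) {N : ℕ} (lam phi : Fin N → ℝ) : Prop where
  data : IsInteriorSpectralData P a lam phi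
  sum_sq : ∑ i, phi i ^ 2 = 1
  sum_mul_sq : ∑ i, lam i * phi i ^ 2 = 0
  ne_zero : ∀ i, phi i ≠ 0

/-- Distinct zeros of `∑ w_i / (λ_i - x)` with positive `w_i` are separated by some `λ_i`. -/
theorem eq_of_sum_div_eq_zero {ι : Type*} [Fintype ι] [Nonempty ι] {w lam : ι → ℝ}
    (hw : ∀ i, 0 < w i) {x y : ℝ} (hxy : ∀ i, 0 < (lam i - x) * (lam i - y))
    (hx : ∑ i, w i / (lam i - x) = 0) (hy : ∑ i, w i / (lam i - y) = 0) : x = y := by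
  have h : (y - x) * ∑ i, w i / ((lam i - x) * (lam i - y)) = 0 := by
    rw [← sub_eq_zero_of_eq (hy.trans hx.symm), ← Finset.sum_sub_distrib, Finset.mul_sum]
    refine Finset.sum_congr rfl fun i _ => ?_
    have h1 : lam i - x ≠ 0 := left_ne_zero_of_mul (hxy i).ne'
    have h2 : lam i - y ≠ 0 := right_ne_zero_of_mul (hxy i).ne'
    field_simp
    ring
  have hpos : 0 < ∑ i, w i / ((lam i - x) * (lam i - y)) :=
    Finset.sum_pos (fun i _ => div_pos (hw i) (hxy i)) Finset.univ_nonempty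
  rcases mul_eq_zero.1 h with h | h
  · linarith
  · exact absurd h hpos.ne'

theorem exists_root_of_mul_neg {p : ℝ[X]} {x y : ℝ} (hxy : x < y)
    (h : p.eval x * p.eval y < 0) : ∃ t, x < t ∧ t < y ∧ p.eval t = 0 := by
  have hc : ContinuousOn (fun t => p.eval t) (Set.Icc x y) := p.continuous.continuousOn
  rcases mul_neg_iff.1 h with ⟨h1, h2⟩ | ⟨h1, h2⟩
  · obtain ⟨t, ht, h0⟩ := intermediate_value_Ioo' hxy.le hc (show (0 : ℝ) ∈ _ from ⟨h2, h1⟩)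
    exact ⟨t, ht.1, ht.2, h0⟩
  · obtain ⟨t, ht, h0⟩ := intermediate_value_Ioo hxy.le hc (show (0 : ℝ) ∈ _ from ⟨h1, h2⟩)
    exact ⟨t, ht.1, ht.2, h0⟩

theorem dataG_ofReal {N : ℕ} (lam phi : Fin N → ℝ) (x : ℝ) :
    dataG lam phi x = ((∑ i, lam i ^ 2 * phi i ^ 2 / (lam i - x) : ℝ) : ℂ) := by
  simp only [dataG, sq_abs]
  push_cast
  rfl

theorem hasDerivAt_dataG {N : ℕ} (lam phi : Fin N → ℝ) {z : ℂ} (hz : ∀ i, z ≠ lam i) :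
    HasDerivAt (dataG lam phi)
      (∑ i, ((lam i ^ 2 * phi i ^ 2 : ℝ) : ℂ) / ((lam i : ℂ) - z) ^ 2) z := by
  have h : HasDerivAt (fun z => ∑ i, ((lam i ^ 2 * |phi i| ^ 2 : ℝ) : ℂ) / ((lam i : ℂ) - z))
      (∑ i, ((lam i ^ 2 * phi i ^ 2 : ℝ) : ℂ) / ((lam i : ℂ) - z) ^ 2) z := by
    refine HasDerivAt.fun_sum fun i _ => ?_
    have h0 : (lam i : ℂ) - z ≠ 0 := sub_ne_zero.2 (hz i).symm
    have := (hasDerivAt_const z (((lam i ^ 2 * |phi i| ^ 2 : ℝ) : ℂ))).div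
      ((hasDerivAt_id z).const_sub (lam i : ℂ)) h0
    refine this.congr_deriv ?_
    simp only [id, sq_abs]
    ring
  exact h

namespace IsBalancedData

variable {P : DiscretePair} {a : ℝ} {N : ℕ} {lam phi : Fin N → ℝ}

theorem nonempty (h : IsBalancedData P a lam phi) : Nonempty (Fin N) := by
  by_contra hne
  rw [not_nonempty_iff] at hne
  have := h.sum_sq
  simp at this

theorem wronskianPoly_eq_zero_iff (h : IsBalancedData P a lam phi) (z : ℂ) :
    aeval z (wronskianPoly P a) = 0 ↔ ∃ i, z = lam i := by
  rw [← mem_spec_iff, h.data.spec_eq]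
  simp [eq_comm]

theorem lam_mem_spec (h : IsBalancedData P a lam phi) (i : Fin N) : (lam i : ℂ) ∈ spec P := by
  rw [h.data.spec_eq]; exact ⟨i, rfl⟩

/-- The norming constants satisfy `λ_i γ_i² > 0`: otherwise the square root in the definition of the
normalized eigenfunction, and with it the quotient `φ_i(a)`, would be `0` by convention. -/
theorem phi_eq (h : IsBalancedData P a lam phi) (i : Fin N) :
    0 < lam i * gammaSq P (lam i) ∧
      (plusPoly P a).eval (lam i) = Real.sqrt (lam i * gammaSq P (lam i)) * phi i := by
  have h1 := h.data.value i
  rw [normalizedEigenfunction, phiPlus_eq_aeval, aeval_ofReal] at h1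
  have h2 : phi i = (plusPoly P a).eval (lam i) / Real.sqrt (lam i * gammaSq P (lam i)) := by
    exact_mod_cast h1
  have h3 : Real.sqrt (lam i * gammaSq P (lam i)) ≠ 0 := by
    intro h0
    rw [h0, div_zero] at h2
    exact h.ne_zero i h2
  refine ⟨?_, by rw [h2]; field_simp⟩
  by_contra h4
  exact h3 (Real.sqrt_eq_zero_of_nonpos (not_lt.1 h4))

theorem lam_ne_zero (h : IsBalancedData P a lam phi) (i : Fin N) : lam i ≠ 0 :=
  left_ne_zero_of_mul (h.phi_eq i).1.ne'

theorem weight_pos (h : IsBalancedData P a lam phi) (i : Fin N) : 0 < lam i ^ 2 * phi i ^ 2 := by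
  have := h.lam_ne_zero i
  have := h.ne_zero i
  positivity

theorem eval_plusPoly_ne_zero (h : IsBalancedData P a lam phi) (i : Fin N) :
    (plusPoly P a).eval (lam i) ≠ 0 := by
  rw [(h.phi_eq i).2]
  exact mul_ne_zero (Real.sqrt_pos.2 (h.phi_eq i).1).ne' (h.ne_zero i)

theorem eval_minusPoly_ne_zero (h : IsBalancedData P a lam phi) (i : Fin N) :
    (minusPoly P a).eval (lam i) ≠ 0 := by
  obtain ⟨c, hc, h1, -⟩ := exists_proportionality a (h.lam_mem_spec i)
  rw [h1]
  exact mul_ne_zero hc (h.eval_plusPoly_ne_zero i)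

theorem derivative_wronskianPoly_ne_zero (h : IsBalancedData P a lam phi) (i : Fin N) :
    (wronskianPoly P a).derivative.eval (lam i) ≠ 0 := by
  obtain ⟨c, hc, -, h2⟩ := exists_proportionality a (h.lam_mem_spec i)
  rw [h2]
  exact mul_ne_zero (neg_ne_zero.2 hc) (right_ne_zero_of_mul (h.phi_eq i).1.ne')

theorem plus_mul_minus_eval (h : IsBalancedData P a lam phi) (i : Fin N) :
    (plusPoly P a * minusPoly P a).eval (lam i) =
      -phi i ^ 2 * (lam i * (wronskianPoly P a).derivative.eval (lam i)) := by
  obtain ⟨c, hc, h1, h2⟩ := exists_proportionality a (h.lam_mem_spec i)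
  have h3 := Real.mul_self_sqrt (h.phi_eq i).1.le
  rw [eval_mul, h1, h2, (h.phi_eq i).2]
  linear_combination (c * phi i ^ 2) * h3

/-- The diagonal Green's function: `z φ₊(z, a) φ₋(z, a) / W(z) = α z + β + G(z)`, where here
`α = β = 0`. -/
theorem aeval_eq_mul_dataG (h : IsBalancedData P a lam phi) {z : ℂ} (hz : ∀ i, z ≠ lam i) :
    z * aeval z (plusPoly P a) * aeval z (minusPoly P a) =
      aeval z (wronskianPoly P a) * dataG lam phi z := by
  classical
  obtain ⟨e1, -, e3, e4⟩ := eval_zero_polys P a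
  have hW : aeval z (wronskianPoly P a) ≠ 0 := fun h0 => by
    obtain ⟨i, hi⟩ := (h.wronskianPoly_eq_zero_iff z).1 h0
    exact hz i hi
  have hsub : ∀ i, (lam i : ℂ) - z ≠ 0 := fun i => sub_ne_zero.2 (hz i).symm
  have hs1 : ∑ i, (phi i : ℂ) ^ 2 = 1 := by exact_mod_cast h.sum_sq
  have hs2 : ∑ i, (lam i : ℂ) * (phi i : ℂ) ^ 2 = 0 := by exact_mod_cast h.sum_mul_sq
  have hG : dataG lam phi z = z + z ^ 2 * ∑ i, (phi i : ℂ) ^ 2 / (lam i - z) := by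
    have : dataG lam phi z = ∑ i, (lam i : ℂ) * (phi i : ℂ) ^ 2 + z * ∑ i, (phi i : ℂ) ^ 2
        + z ^ 2 * ∑ i, (phi i : ℂ) ^ 2 / (lam i - z) := by
      rw [Finset.mul_sum, Finset.mul_sum, ← Finset.sum_add_distrib, ← Finset.sum_add_distrib, dataG]
      refine Finset.sum_congr rfl fun i _ => ?_
      have := hsub i
      rw [sq_abs]
      push_cast
      field_simp
      ring
    rw [this, hs1, hs2]; ring
  rcases eq_or_ne z 0 with rfl | hz0
  · rw [hG]; simp
  have hW0 : wronskianPoly P a ≠ 0 := fun h0 => hW (by simp [h0])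
  set φ := algebraMap ℝ ℂ
  set A : ℂ[X] := (plusPoly P a * minusPoly P a).map φ with hA
  set B : ℂ[X] := (X * wronskianPoly P a).map φ with hB
  have hBr : ∀ r, B.eval r = r * aeval r (wronskianPoly P a) := fun r => by
    rw [hB, eval_map_algebraMap, map_mul, aeval_X]
  have hBd : ∀ r : ℝ, B.derivative.eval (r : ℂ) =
      (((wronskianPoly P a).eval r + r * (wronskianPoly P a).derivative.eval r : ℝ) : ℂ) := by
    intro r
    rw [hB, derivative_map, eval_map_algebraMap, aeval_ofReal]
    simp
  have hAr : ∀ r : ℝ, A.eval (r : ℂ) = (((plusPoly P a * minusPoly P a).eval r : ℝ) : ℂ) :=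
    fun r => by rw [hA, eval_map_algebraMap, aeval_ofReal]
  have hWi : ∀ i, (wronskianPoly P a).eval (lam i) = 0 := fun i => by
    have := (h.wronskianPoly_eq_zero_iff (lam i)).2 ⟨i, rfl⟩
    rw [aeval_ofReal] at this
    exact_mod_cast this
  have hinj : Function.Injective fun i => (lam i : ℂ) :=
    Complex.ofReal_injective.comp h.data.strictMono.injective
  have h0mem : (0 : ℂ) ∉ Finset.univ.image fun i => (lam i : ℂ) := by
    simp only [Finset.mem_image, Finset.mem_univ, true_and, not_exists]
    intro i hi
    exact h.lam_ne_zero i (by exact_mod_cast hi)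
  -- partial fractions of `φ₊ φ₋ / (z W)`, which is proper because `deg (φ₊ φ₋) ≤ deg W`
  have pf := eval_div_eval_eq_sum (A := A) (B := B)
    (s := insert 0 (Finset.univ.image fun i => (lam i : ℂ))) (z := z)
    (fun r => by
      rw [hBr, mul_eq_zero, h.wronskianPoly_eq_zero_iff]
      simp [eq_comm])
    (by
      intro r hr
      rcases Finset.mem_insert.1 hr with rfl | hr
      · have := hBd 0
        rw [Complex.ofReal_zero] at this
        rw [this, e4]; simp
      · obtain ⟨i, -, rfl⟩ := Finset.mem_image.1 hr
        rw [hBd, hWi, zero_add]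
        exact_mod_cast mul_ne_zero (h.lam_ne_zero i) (h.derivative_wronskianPoly_ne_zero i))
    (by
      rw [hA, hB, natDegree_map, natDegree_map, natDegree_X_mul hW0]
      exact Nat.lt_succ_of_le (natDegree_plusPoly_mul_minusPoly_le P a))
    (by
      simp only [Finset.mem_insert, Finset.mem_image, Finset.mem_univ, true_and, not_or, not_exists]
      exact ⟨hz0, fun i hi => hz i hi.symm⟩)
  rw [Finset.sum_insert h0mem, Finset.sum_image fun i _ j _ hij => hinj hij, hBr] at pf
  have t0 : A.eval 0 / (B.derivative.eval 0 * (z - 0)) = 1 / z := by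
    have h1 := hBd 0
    have h2 := hAr 0
    rw [Complex.ofReal_zero] at h1 h2
    have h3 := exp_half_mul_exp_neg_half a
    rw [h1, h2, e4, eval_mul, e1, e3, mul_comm (Real.exp _), h3]
    simp
  have ti : ∀ i, A.eval (lam i : ℂ) / (B.derivative.eval (lam i : ℂ) * (z - lam i)) =
      (phi i : ℂ) ^ 2 / (lam i - z) := by
    intro i
    have h1 : (((wronskianPoly P a).derivative.eval (lam i) : ℝ) : ℂ) ≠ 0 := by
      exact_mod_cast h.derivative_wronskianPoly_ne_zero i
    have h2 : (lam i : ℂ) ≠ 0 := by exact_mod_cast h.lam_ne_zero i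
    have h3 := hsub i
    have h4 : z - (lam i : ℂ) ≠ 0 := sub_ne_zero.2 (hz i)
    rw [hAr, hBd, hWi, h.plus_mul_minus_eval]
    push_cast
    rw [zero_add, div_eq_div_iff (mul_ne_zero (mul_ne_zero h2 h1) h4) h3]
    ring
  rw [t0, Finset.sum_congr rfl fun i _ => ti i, hA, eval_map_algebraMap, map_mul,
    div_eq_iff (mul_ne_zero hz0 hW)] at pf
  rw [hG]
  calc _ = z * (aeval z (plusPoly P a) * aeval z (minusPoly P a)) := by ring
    _ = _ := by
      rw [pf]
      field_simp

theorem dataG_ne_zero (h : IsBalancedData P a lam phi) {z : ℂ} (hz : z.im ≠ 0) :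
    dataG lam phi z ≠ 0 := by
  intro h0
  have hne := h.nonempty
  have h1 : (dataG lam phi z).im =
      z.im * ∑ i, lam i ^ 2 * phi i ^ 2 / Complex.normSq (lam i - z) := by
    rw [dataG, Complex.im_sum, Finset.mul_sum]
    refine Finset.sum_congr rfl fun i _ => ?_
    rw [Complex.div_im, Complex.ofReal_im, Complex.ofReal_re, sq_abs, Complex.sub_im,
      Complex.ofReal_im]
    ring
  rw [h0, Complex.zero_im] at h1
  have hpos : 0 < ∑ i, lam i ^ 2 * phi i ^ 2 / Complex.normSq (lam i - z) := by
    refine Finset.sum_pos (fun i _ => div_pos (h.weight_pos i) ?_) Finset.univ_nonempty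
    refine Complex.normSq_pos.2 fun h2 => hz ?_
    have := congrArg Complex.im h2
    simpa using this
  exact mul_ne_zero hz hpos.ne' h1.symm

theorem aeval_minusPoly_eq_zero (h : IsBalancedData P a lam phi) {z : ℂ}
    (hz : aeval z (minusPoly P a) = 0) :
    z ≠ 0 ∧ (∀ i, z ≠ lam i) ∧ dataG lam phi z = 0 ∧ z.im = 0 := by
  have h1 : z ≠ 0 := by
    rintro rfl
    have := aeval_ofReal (minusPoly P a) 0
    rw [Complex.ofReal_zero, hz, (eval_zero_polys P a).1] at this
    exact (Real.exp_pos _).ne (by exact_mod_cast this)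
  have h2 : ∀ i, z ≠ lam i := by
    rintro i rfl
    rw [aeval_ofReal] at hz
    exact h.eval_minusPoly_ne_zero i (by exact_mod_cast hz)
  have h3 : dataG lam phi z = 0 := by
    have := h.aeval_eq_mul_dataG h2
    rw [hz, mul_zero] at this
    rcases mul_eq_zero.1 this.symm with h0 | h0
    · obtain ⟨i, hi⟩ := (h.wronskianPoly_eq_zero_iff z).1 h0
      exact absurd hi (h2 i)
    · exact h0
  refine ⟨h1, h2, h3, ?_⟩
  by_contra h4
  exact h.dataG_ne_zero h4 h3

theorem deriv_dataG_ne_zero (h : IsBalancedData P a lam phi) {x : ℝ} (hx : ∀ i, x ≠ lam i) :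
    deriv (dataG lam phi) x ≠ 0 := by
  have hne := h.nonempty
  have hx' : ∀ i, (x : ℂ) ≠ lam i := fun i => by exact_mod_cast hx i
  rw [(hasDerivAt_dataG lam phi hx').deriv]
  have hpos : 0 < ∑ i, lam i ^ 2 * phi i ^ 2 / (lam i - x) ^ 2 := by
    refine Finset.sum_pos (fun i _ => div_pos (h.weight_pos i) ?_) Finset.univ_nonempty
    have : lam i - x ≠ 0 := sub_ne_zero.2 (hx i).symm
    positivity
  have : (∑ i, ((lam i ^ 2 * phi i ^ 2 : ℝ) : ℂ) / ((lam i : ℂ) - x) ^ 2) =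
      ((∑ i, lam i ^ 2 * phi i ^ 2 / (lam i - x) ^ 2 : ℝ) : ℂ) := by push_cast; rfl
  rw [this]
  exact_mod_cast hpos.ne'

theorem eval_wronskianPoly_ne_zero (h : IsBalancedData P a lam phi) {x : ℝ} (hx : ∀ i, x ≠ lam i) :
    (wronskianPoly P a).eval x ≠ 0 := by
  intro h0
  obtain ⟨i, hi⟩ := (h.wronskianPoly_eq_zero_iff x).1 (by rw [aeval_ofReal, h0]; simp)
  exact hx i (by exact_mod_cast hi)

/-- The derivative of `z φ₊ φ₋ = W G` at a real zero of `G`. -/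
theorem derivative_eq_mul_deriv_dataG (h : IsBalancedData P a lam phi) {x : ℝ}
    (hx : ∀ i, x ≠ lam i) (h0 : dataG lam phi x = 0) :
    (((X * plusPoly P a * minusPoly P a).derivative.eval x : ℝ) : ℂ) =
      (((wronskianPoly P a).eval x : ℝ) : ℂ) * deriv (dataG lam phi) x := by
  have hx' : ∀ i, (x : ℂ) ≠ lam i := fun i => by exact_mod_cast hx i
  have h1 := (X * plusPoly P a * minusPoly P a).hasDerivAt_aeval (x : ℂ)
  have hG := hasDerivAt_dataG lam phi hx'
  have h2 := ((wronskianPoly P a).hasDerivAt_aeval (x : ℂ)).mul hG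
  have hev : (fun z : ℂ => aeval z (X * plusPoly P a * minusPoly P a)) =ᶠ[𝓝 (x : ℂ)]
      fun z => aeval z (wronskianPoly P a) * dataG lam phi z := by
    have hfin : (Set.range fun i => (lam i : ℂ))ᶜ ∈ 𝓝 (x : ℂ) :=
      (Set.finite_range _).isClosed.isOpen_compl.mem_nhds (by
        rintro ⟨i, hi⟩; exact hx' i hi.symm)
    filter_upwards [hfin] with z hz
    rw [← h.aeval_eq_mul_dataG fun i hi => hz ⟨i, hi.symm⟩]
    simp
  have h3 := (h2.congr_of_eventuallyEq hev).unique h1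
  rw [hG.deriv, ← aeval_ofReal, ← aeval_ofReal, ← h3, h0]
  ring

theorem plus_minus_not_both_zero (h : IsBalancedData P a lam phi) {x : ℝ} (hx : ∀ i, x ≠ lam i)
    (h1 : (plusPoly P a).eval x = 0) (h2 : (minusPoly P a).eval x = 0) : False := by
  refine h.eval_wronskianPoly_ne_zero hx ?_
  rw [wronskianPoly_eq, eval_add, eval_mul, eval_mul, h1, h2]
  ring

theorem dataG_eq_zero_of_eval_plusPoly (h : IsBalancedData P a lam phi) {x : ℝ}
    (hx : ∀ i, x ≠ lam i) (h1 : (plusPoly P a).eval x = 0) : dataG lam phi x = 0 := by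
  have := h.aeval_eq_mul_dataG (z := x) fun i => by exact_mod_cast hx i
  simp only [aeval_ofReal, h1, Complex.ofReal_zero, mul_zero, zero_mul] at this
  rcases mul_eq_zero.1 this.symm with h0 | h0
  · exact absurd (by exact_mod_cast h0) (h.eval_wronskianPoly_ne_zero hx)
  · exact h0

theorem lam_lt_or_lt_lam_of_gap (h : IsBalancedData P a lam phi) {i j : Fin N}
    (hij : (j : ℕ) = i + 1) {x : ℝ}
    (h1 : lam i < x) (h2 : x < lam j) (l : Fin N) : lam l < x ∧ lam l ≤ lam i ∨
      x < lam l ∧ lam j ≤ lam l := by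
  rcases le_or_gt l i with hl | hl
  · have := h.data.strictMono.monotone hl
    exact Or.inl ⟨this.trans_lt h1, this⟩
  · have : j ≤ l := by rw [Fin.le_def]; rw [Fin.lt_def] at hl; omega
    have := h.data.strictMono.monotone this
    exact Or.inr ⟨h2.trans_le this, this⟩

/-- `G` has at most one zero between consecutive eigenvalues. -/
theorem dataG_zero_unique (h : IsBalancedData P a lam phi) {i j : Fin N} (hij : (j : ℕ) = i + 1)
    {x y : ℝ} (hx : x ∈ Set.Ioo (lam i) (lam j)) (hy : y ∈ Set.Ioo (lam i) (lam j))
    (hx0 : dataG lam phi x = 0) (hy0 : dataG lam phi y = 0) : x = y := by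
  have hne := h.nonempty
  rw [dataG_ofReal] at hx0 hy0
  refine eq_of_sum_div_eq_zero h.weight_pos (fun l => ?_) (by exact_mod_cast hx0)
    (by exact_mod_cast hy0)
  rcases h.lam_lt_or_lt_lam_of_gap hij hx.1 hx.2 l with h1 | h1
  · exact mul_pos_of_neg_of_neg (by linarith [h1.1]) (by linarith [h1.2, hy.1])
  · exact mul_pos (by linarith [h1.1]) (by linarith [h1.2, hy.2])

theorem phi_mul_pos_iff (h : IsBalancedData P a lam phi) (i j : Fin N) :
    0 < phi i * phi j ↔ 0 < (plusPoly P a).eval (lam i) * (plusPoly P a).eval (lam j) := by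
  have h1 := Real.sqrt_pos.2 (h.phi_eq i).1
  have h2 := Real.sqrt_pos.2 (h.phi_eq j).1
  rw [(h.phi_eq i).2, (h.phi_eq j).2, mul_mul_mul_comm]
  exact (mul_pos_iff_of_pos_left (mul_pos h1 h2)).symm

theorem exists_gap (h : IsBalancedData P a lam phi) {x : ℝ} (hx : ∀ i, x ≠ lam i)
    (h0 : dataG lam phi x = 0) :
    ∃ i j : Fin N, (j : ℕ) = i + 1 ∧ lam i < x ∧ x < lam j := by
  classical
  have hne := h.nonempty
  rw [dataG_ofReal] at h0
  have h0' : ∑ i, lam i ^ 2 * phi i ^ 2 / (lam i - x) = 0 := by exact_mod_cast h0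
  have hlow : ∃ i, lam i < x := by
    by_contra hh
    push Not at hh
    refine (Finset.sum_pos (fun i _ => div_pos (h.weight_pos i) ?_) Finset.univ_nonempty).ne' h0'
    exact sub_pos.2 (lt_of_le_of_ne (hh i) (hx i))
  have hhigh : ∃ i, x < lam i := by
    by_contra hh
    push Not at hh
    refine (Finset.sum_neg (fun i _ => div_neg_of_pos_of_neg (h.weight_pos i) ?_)
      Finset.univ_nonempty).ne h0'
    exact sub_neg.2 (lt_of_le_of_ne (hh i) (hx i).symm)
  obtain ⟨i0, hi0⟩ := hlow
  obtain ⟨j0, hj0⟩ := hhigh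
  have hF : (Finset.univ.filter fun i => lam i < x).Nonempty := ⟨i0, by simp [hi0]⟩
  obtain ⟨i, hi, hmax⟩ := Finset.exists_max_image _ id hF
  have hix : lam i < x := (Finset.mem_filter.1 hi).2
  have hij : i < j0 := h.data.strictMono.lt_iff_lt.1 (hix.trans hj0)
  have hlt : (i : ℕ) + 1 < N := lt_of_le_of_lt (Fin.lt_def.1 hij) j0.isLt
  refine ⟨i, ⟨i + 1, hlt⟩, rfl, hix, ?_⟩
  by_contra hh
  have h1 : lam ⟨i + 1, hlt⟩ < x := lt_of_le_of_ne (not_lt.1 hh) (hx _).symm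
  have h2 := hmax ⟨i + 1, hlt⟩ (by simp [h1])
  simp only [id, Fin.le_def] at h2
  omega

/-- The poles of `M₋` are the zeros of `φ₋(·, a)`: in a gap that contains a zero of `G`, the
function `φ₊(·, a)` has no zero if that zero belongs to `φ₋(·, a)`, and a single simple one
otherwise, so the signs of `φ₊` at the ends of the gap tell which case occurs. -/
theorem mem_dataPolesMinus_iff (h : IsBalancedData P a lam phi) (x : ℝ) :
    x ∈ dataPolesMinus lam phi ↔ (minusPoly P a).eval x = 0 := by
  have hgap : ∀ i j : Fin N, (j : ℕ) = i + 1 → ∀ t, lam i < t → t < lam j → ∀ l, t ≠ lam l := by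
    intro i j hij t h1 h2 l hl
    rcases h.lam_lt_or_lt_lam_of_gap hij h1 h2 l with h3 | h3
    · exact h3.1.ne hl.symm
    · exact h3.1.ne hl
  constructor
  · rintro ⟨hx0, hG, i, j, hij, h1, h2, hpos⟩
    have hx := hgap i j hij x h1 h2
    by_contra hm
    have hp : (plusPoly P a).eval x = 0 := by
      have := h.aeval_eq_mul_dataG (z := x) fun i => by exact_mod_cast hx i
      rw [hG, mul_zero, aeval_ofReal, aeval_ofReal] at this
      have h3 : x * (plusPoly P a).eval x * (minusPoly P a).eval x = 0 := by exact_mod_cast this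
      simpa [hx0, hm] using h3
    obtain ⟨q, hq⟩ := dvd_iff_isRoot.2 hp
    rw [h.phi_mul_pos_iff, hq] at hpos
    simp only [eval_mul, eval_sub, eval_X, eval_C] at hpos
    have hneg : (lam i - x) * (lam j - x) < 0 :=
      mul_neg_of_neg_of_pos (by linarith) (by linarith)
    have hq' : q.eval (lam i) * q.eval (lam j) < 0 := by
      by_contra hh
      have := mul_nonpos_of_nonpos_of_nonneg hneg.le (not_lt.1 hh)
      linarith
    obtain ⟨t, ht1, ht2, ht0⟩ := exists_root_of_mul_neg (h1.trans h2) hq'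
    have htG := h.dataG_eq_zero_of_eval_plusPoly (hgap i j hij t ht1 ht2) (by
      rw [hq, eval_mul, ht0, mul_zero])
    have htx : t = x := h.dataG_zero_unique hij ⟨ht1, ht2⟩ ⟨h1, h2⟩ htG hG
    subst htx
    -- now `t` is a double zero of `φ₊`, contradicting `G' > 0`
    have hd := h.derivative_eq_mul_deriv_dataG hx hG
    have : (X * plusPoly P a * minusPoly P a).derivative.eval t = 0 := by
      rw [hq]
      simp [ht0]
    rw [this, Complex.ofReal_zero] at hd
    exact mul_ne_zero (by exact_mod_cast h.eval_wronskianPoly_ne_zero hx)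
      (h.deriv_dataG_ne_zero hx) hd.symm
  · intro hm
    obtain ⟨hx0, hx, hG, -⟩ := h.aeval_minusPoly_eq_zero (z := x) (by rw [aeval_ofReal, hm]; simp)
    have hx' : ∀ i, x ≠ lam i := fun i => by exact_mod_cast hx i
    obtain ⟨i, j, hij, h1, h2⟩ := h.exists_gap hx' hG
    refine ⟨by exact_mod_cast hx0, hG, i, j, hij, h1, h2, ?_⟩
    rw [h.phi_mul_pos_iff]
    by_contra hh
    have hneg : (plusPoly P a).eval (lam i) * (plusPoly P a).eval (lam j) < 0 :=
      lt_of_le_of_ne (not_lt.1 hh)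
        (mul_ne_zero (h.eval_plusPoly_ne_zero i) (h.eval_plusPoly_ne_zero j))
    obtain ⟨t, ht1, ht2, ht0⟩ := exists_root_of_mul_neg (h1.trans h2) hneg
    have htl := hgap i j hij t ht1 ht2
    have htG := h.dataG_eq_zero_of_eval_plusPoly htl ht0
    have htx : t = x := h.dataG_zero_unique hij ⟨ht1, ht2⟩ ⟨h1, h2⟩ htG hG
    subst htx
    exact h.plus_minus_not_both_zero hx' ht0 hm

/-- The residues of `M₋ = -φ₋' / (z φ₋)` are those of `-1 / G`, and the zeros of `φ₋(·, a)` are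
simple. -/
theorem residue_eq (h : IsBalancedData P a lam phi) {x : ℝ} (hx : (minusPoly P a).eval x = 0) :
    (minusPoly P a).derivative.eval x ≠ 0 ∧
    1 / deriv (dataG lam phi) x =
      (((minusSlopePoly P a).eval x / (x * (minusPoly P a).derivative.eval x) : ℝ) : ℂ) := by
  obtain ⟨hx0, hxl, hG, -⟩ := h.aeval_minusPoly_eq_zero (z := x) (by rw [aeval_ofReal, hx]; simp)
  have hx' : ∀ i, x ≠ lam i := fun i => by exact_mod_cast hxl i
  have hW := h.eval_wronskianPoly_ne_zero hx'
  have hG' := h.deriv_dataG_ne_zero hx'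
  have hd := h.derivative_eq_mul_deriv_dataG hx' hG
  have e1 : (X * plusPoly P a * minusPoly P a).derivative.eval x =
      x * (plusPoly P a).eval x * (minusPoly P a).derivative.eval x := by
    simp [hx]
  have e2 : (wronskianPoly P a).eval x = (plusPoly P a).eval x * (minusSlopePoly P a).eval x := by
    rw [wronskianPoly_eq]; simp [hx]
  have hne : (((X * plusPoly P a * minusPoly P a).derivative.eval x : ℝ) : ℂ) ≠ 0 := by
    rw [hd]; exact mul_ne_zero (by exact_mod_cast hW) hG'
  have hne' : x * (plusPoly P a).eval x * (minusPoly P a).derivative.eval x ≠ 0 := by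
    rw [← e1]; exact_mod_cast hne
  have h3 := right_ne_zero_of_mul hne'
  have h2 := right_ne_zero_of_mul (left_ne_zero_of_mul hne')
  refine ⟨h3, ?_⟩
  rw [e1, e2] at hd
  push_cast at hd ⊢
  have h2' : (((plusPoly P a).eval x : ℝ) : ℂ) ≠ 0 := by exact_mod_cast h2
  have h3' : (((minusPoly P a).derivative.eval x : ℝ) : ℂ) ≠ 0 := by exact_mod_cast h3
  rw [div_eq_div_iff hG' (mul_ne_zero hx0 h3')]
  refine mul_left_cancel₀ h2' ?_
  linear_combination hd

theorem weylMinus_eq (h : IsBalancedData P a lam phi) {z : ℂ} (hz : z.im ≠ 0) :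
    weylMinus P a z = dataMinus lam phi z := by
  classical
  obtain ⟨e1, e2, -, -⟩ := eval_zero_polys P a
  have hm0 : minusPoly P a ≠ 0 := fun h0 => by
    rw [h0, eval_zero] at e1
    exact (Real.exp_pos _).ne e1
  set Z : Finset ℝ := (minusPoly P a).roots.toFinset with hZ
  have hZmem : ∀ x, x ∈ Z ↔ (minusPoly P a).eval x = 0 := fun x => by
    rw [hZ, Multiset.mem_toFinset, mem_roots hm0, IsRoot.def]
  have hset : dataPolesMinus lam phi = (Z : Set ℝ) := by
    ext x
    rw [h.mem_dataPolesMinus_iff, Finset.mem_coe, hZmem]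
  set A : ℂ[X] := (minusSlopePoly P a).map (algebraMap ℝ ℂ) with hA
  set B : ℂ[X] := (X * minusPoly P a).map (algebraMap ℝ ℂ) with hB
  have hAr : ∀ r : ℝ, A.eval (r : ℂ) = (((minusSlopePoly P a).eval r : ℝ) : ℂ) :=
    fun r => by rw [hA, eval_map_algebraMap, aeval_ofReal]
  have hBr : ∀ r, B.eval r = r * aeval r (minusPoly P a) := fun r => by
    rw [hB, eval_map_algebraMap, map_mul, aeval_X]
  have hBd : ∀ r : ℝ, B.derivative.eval (r : ℂ) =
      (((minusPoly P a).eval r + r * (minusPoly P a).derivative.eval r : ℝ) : ℂ) := by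
    intro r
    rw [hB, derivative_map, eval_map_algebraMap, aeval_ofReal]
    simp
  have hZ0 : ∀ x ∈ Z, x ≠ 0 := fun x hx => by
    have := (h.aeval_minusPoly_eq_zero (z := x) (by rw [aeval_ofReal, (hZmem x).1 hx]; simp)).1
    exact_mod_cast this
  have h0mem : (0 : ℂ) ∉ Z.image fun x : ℝ => (x : ℂ) := by
    rw [Finset.mem_image]
    rintro ⟨x, hx, hx0⟩
    exact hZ0 x hx (by exact_mod_cast hx0)
  -- partial fractions of `φ₋' / (z φ₋)`, which is proper because `deg φ₋' ≤ deg φ₋`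
  have pf := eval_div_eval_eq_sum (A := A) (B := B)
    (s := insert 0 (Z.image fun x : ℝ => (x : ℂ))) (z := z)
    (fun r => by
      rw [hBr, mul_eq_zero, Finset.mem_insert, Finset.mem_image]
      refine or_congr_right ⟨fun hr => ?_, ?_⟩
      · have him := (h.aeval_minusPoly_eq_zero hr).2.2.2
        have hre : r = (r.re : ℂ) := Complex.ext rfl (by simp [him])
        refine ⟨r.re, (hZmem _).2 ?_, hre.symm⟩
        rw [hre, aeval_ofReal] at hr
        exact_mod_cast hr
      · rintro ⟨x, hx, rfl⟩
        rw [aeval_ofReal, (hZmem x).1 hx]; simp)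
    (by
      intro r hr
      rcases Finset.mem_insert.1 hr with rfl | hr
      · have := hBd 0
        rw [Complex.ofReal_zero] at this
        rw [this, e1]
        simp
      · obtain ⟨x, hx, rfl⟩ := Finset.mem_image.1 hr
        have hx' := (hZmem x).1 hx
        rw [hBd, hx', zero_add]
        exact_mod_cast mul_ne_zero (hZ0 x hx) (h.residue_eq hx').1)
    (by
      rw [hA, hB, natDegree_map, natDegree_map, natDegree_X_mul hm0]
      exact Nat.lt_succ_of_le (natDegree_minusSlopePoly_le P a))
    (by
      rw [Finset.mem_insert, Finset.mem_image]
      rintro (rfl | ⟨x, -, rfl⟩)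
      · exact hz rfl
      · exact hz (Complex.ofReal_im x))
  rw [Finset.sum_insert h0mem, Finset.sum_image fun x _ y _ hxy => Complex.ofReal_injective hxy,
    hBr, hA, eval_map_algebraMap, ← hA] at pf
  rw [weylMinus, leftDeriv_phiMinus, phiMinus_eq_aeval, pf, dataMinus, hset, finsum_mem_coe_finset,
    neg_add, ← Finset.sum_neg_distrib]
  have hz0 : z ≠ 0 := by rintro rfl; exact hz rfl
  congr 1
  · have h1 := hBd 0
    have h2 := hAr 0
    rw [Complex.ofReal_zero] at h1 h2
    rw [h1, h2, e1, e2]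
    have : (Real.exp (a / 2) : ℂ) ≠ 0 := by exact_mod_cast (Real.exp_pos _).ne'
    push_cast at this ⊢
    field_simp
    ring
  · refine Finset.sum_congr rfl fun x hx => ?_
    have hx' := (hZmem x).1 hx
    obtain ⟨h1, h2⟩ := h.residue_eq hx'
    have hxz : (x : ℂ) - z ≠ 0 := fun h0 => hz (by
      rw [← sub_eq_zero.1 h0]; exact Complex.ofReal_im x)
    have hzx : z - (x : ℂ) ≠ 0 := fun h0 => hxz (by linear_combination -h0)
    rw [h2, hAr, hBd, hx', zero_add]
    push_cast
    rw [← div_div, ← div_neg, neg_sub]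

theorem weylPlus_eq (h : IsBalancedData P a lam phi) {z : ℂ} (hz : z.im ≠ 0) :
    weylPlus P a z = dataPlus lam phi z := by
  have hzl : ∀ i, z ≠ lam i := by
    rintro i rfl; exact hz (Complex.ofReal_im _)
  have hz0 : z ≠ 0 := by rintro rfl; exact hz rfl
  have hG := h.dataG_ne_zero hz
  have hW : aeval z (wronskianPoly P a) ≠ 0 := fun h0 => by
    obtain ⟨i, hi⟩ := (h.wronskianPoly_eq_zero_iff z).1 h0
    exact hzl i hi
  have key := h.aeval_eq_mul_dataG hzl
  have hne : z * aeval z (plusPoly P a) * aeval z (minusPoly P a) ≠ 0 := by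
    rw [key]; exact mul_ne_zero hW hG
  have hm := right_ne_zero_of_mul hne
  have hp := right_ne_zero_of_mul (left_ne_zero_of_mul hne)
  rw [dataPlus, ← h.weylMinus_eq hz, weylPlus, weylMinus, leftDeriv_phiPlus, leftDeriv_phiMinus,
    phiPlus_eq_aeval, phiMinus_eq_aeval]
  have hG' : dataG lam phi z = z * aeval z (plusPoly P a) * aeval z (minusPoly P a) /
      aeval z (wronskianPoly P a) := by
    rw [key]; field_simp
  rw [hG', wronskianPoly_eq]
  rw [wronskianPoly_eq] at hW
  simp only [map_add, map_mul] at hW ⊢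
  field_simp
  ring

theorem isReconstruction (h : IsBalancedData P a lam phi) : IsReconstruction P a lam phi :=
  fun _ hz => ⟨h.weylPlus_eq hz, h.weylMinus_eq hz⟩

end IsBalancedData

theorem IsReconstruction.unique {P P' : DiscretePair} {a : ℝ} {N : ℕ} {lam phi : Fin N → ℝ}
    (h : IsReconstruction P a lam phi) (h' : IsReconstruction P' a lam phi) : P = P' :=
  eq_of_weyl_eq (fun z hz => (h z hz).2.trans (h' z hz).2.symm)
    fun z hz => (h z hz).1.trans (h' z hz).1.symm

end Peakon

theorem theorem3p3 (a : ℝ) (N : ℕ) (lam phi : Fin N → ℝ)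
    (hdata : ∃ P : Peakon.DiscretePair, Peakon.IsInteriorSpectralData P a lam phi)
    (halpha : 1 - ∑ i, |phi i| ^ 2 = 0)
    (hbeta : -∑ i, lam i * |phi i| ^ 2 = 0)
    (hphi : ∀ i, phi i ≠ 0) :
    (∃! P : Peakon.DiscretePair, Peakon.IsInteriorSpectralData P a lam phi) ∧
    (∃! P : Peakon.DiscretePair, Peakon.IsReconstruction P a lam phi) ∧
    (∀ P : Peakon.DiscretePair, Peakon.IsReconstruction P a lam phi →
      Peakon.IsInteriorSpectralData P a lam phi) := by
  simp only [sq_abs] at halpha hbeta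
  have hrec : ∀ P : Peakon.DiscretePair, Peakon.IsInteriorSpectralData P a lam phi →
      Peakon.IsReconstruction P a lam phi := fun P hP =>
    Peakon.IsBalancedData.isReconstruction ⟨hP, by linarith, by linarith, hphi⟩
  obtain ⟨P, hP⟩ := hdata
  refine ⟨⟨P, hP, fun Q hQ => (hrec Q hQ).unique (hrec P hP)⟩,
    ⟨P, hrec P hP, fun Q hQ => hQ.unique (hrec P hP)⟩, fun Q hQ => ?_⟩
  rwa [hQ.unique (hrec P hP)]
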